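/- Let $M$ be a finite-dimensional smooth manifold and let $(\mathfrak g,\mathfrak h,dt,d\alpha)$ be a differential crossed module of finite-dimensional real Lie algebras, i.e. $dt:\mathfrak h\to\mathfrak g$ is a Lie algebra homomorphism and $d\alpha:\mathfrak g\to\mathrm{Der}(\mathfrak h)$ an action by derivations with $dt(d\alpha(x)(y))=[x,dt(y)]$ and $d\alpha(dt(y))(y')=[y,y']$. Let $T_a$ be a basis of $\mathfrak g$, and write $x=x^aT_a$. Let $A\in\Omega^1(M,\mathfrak g)$ and $B\in\Omega^2(M,\mathfrak h)$ be smooth, and put $$F_A=\mathbf dA+\tfrac12A^a\wedge A^b[T_a,T_b],\qquad \mathbf d_AB=\mathbf dB+A^a\wedge d\alpha(T_a)(B).$$ For $s,t\in M$ let $\mathcal P_s^t(M)$ be the space of smooth paths $X:[0,1]\to M$ from $s$ to $t$ that are constant near $0$ and near $1$, with the smooth structure whose plots are the families $u\mapsto X_u$, $u\in\mathbb R^n$, for which $(u,\sigma)\mapsto X_u(\sigma)$ is smooth. Differential forms on $\mathcal P_s^t(M)$, their wedge products and their exterior derivative are understood plot by plot: a form assigns to each plot a smooth form on $\mathbb R^n$,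 compatibly with smooth changes of the parameters. For a form $\omega$ on $M$ let $\omega(\sigma)=e_\sigma^*\omega$ be its pullback along $e_\sigma:X\mapsto X(\sigma)$, and let $\iota_K\omega(\sigma)$ be its contraction with the vector field $K(X)=X'$. For $\omega$ with values in $\mathfrak h$ let $$\omega^{W_A}(\sigma)=\sum_{N\ge0}\ \int\limits_{\sigma<\sigma_1<\dots<\sigma_N<1}d\alpha\big(-A(X'(\sigma_N))\big)\circ\cdots\circ d\alpha\big(-A(X'(\sigma_1))\big)\,\big(\omega(\sigma)\big)\,d\sigma_1\cdots d\sigma_N$$ be its parallel transport along $X$ from $\sigma$ to $1$, and likewise, with the adjoint action in the place of $d\alpha$, for $\omega$ with values in $\mathfrak g$. Set $$\oint_A(\omega)=\int_0^1\iota_K\omega^{W_A}(\sigma)\,d\sigma ,\qquad \oint_A\big(d\alpha(T_a)(B),\Phi^a\big)=\int\limits_{0<\sigma_1<\sigma_2<1}d\alpha(T_a)\big(\iota_KB^{W_A}(\sigma_1)\big)\wedge\big(\iota_K\Phi^{W_A}(\sigma_2)\big)^a\,d\sigma_1\,d\sigma_2$$ for $\Phi\in\Omega^2(M,\mathfrak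 g)$. Then these series converge, the integrands used below are continuous in $\sigma$, and $\oint_A(B)$, $\oint_A(\mathbf d_AB)$ and $\oint_A(d\alpha(T_a)(B),(F_A+dt(B))^a)$ are differential forms on $\mathcal P_s^t(M)$. The curvature $\mathcal F_{\mathcal A}=\mathbf d\mathcal A+\mathcal A\wedge\mathcal A$ of the standard path space connection 1-form $\mathcal A=\oint_A(B)$, where $(\mathcal A\wedge\mathcal A)(v,w)=[\mathcal A(v),\mathcal A(w)]$, is $$\mathcal F_{\mathcal A}=-\oint_A(\mathbf d_AB)-\oint_A\big(d\alpha(T_a)(B),(F_A+dt(B))^a\big).$$ In particular, if the fake curvature $F_A+dt(B)$ vanishes, then $\mathcal F_{\mathcal A}=-\oint_A(H)$ with $H=\mathbf d_AB$. -/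

import Mathlib

open Set Diffeology
open scoped Manifold ContDiff Topology

noncomputable section

namespace PathCurvature

/-! ### Differential crossed modules -/

/-- A Lie ring carrying a norm that induces the additive group structure. No compatibility of norm
and bracket is required: on a finite-dimensional Lie algebra every norm is allowed, and the norm
only serves to express smoothness. -/
class NormedLieRing (L : Type*) extends NormedAddCommGroup L, LieRing L

/-- A real Lie algebra carrying a vector space norm. -/
class NormedLieAlg (L : Type*) [NormedLieRing L] extends NormedSpace ℝ L, LieAlgebra ℝ L

/-- A differential crossed module `(𝔤, 𝔥, dt, dα)`: a Lie algebra homomorphism `dt : 𝔥 → 𝔤` and an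
action `dα : 𝔤 → Der 𝔥` by derivations with `dt (dα x y) = [x, dt y]` and
`dα (dt y) y' = [y, y']`. -/
structure DifferentialCrossedModule (𝔤 𝔥 : Type*) [LieRing 𝔤] [LieAlgebra ℝ 𝔤]
    [LieRing 𝔥] [LieAlgebra ℝ 𝔥] where
  dt : 𝔥 →ₗ⁅ℝ⁆ 𝔤
  dα : 𝔤 →ₗ⁅ℝ⁆ LieDerivation ℝ 𝔥 𝔥
  dt_dα : ∀ (x : 𝔤) (y : 𝔥), dt (dα x y) = ⁅x, dt y⁆
  dα_dt : ∀ y y' : 𝔥, dα (dt y) y' = ⁅y, y'⁆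

section Bilinear

variable {𝔤 𝔥 : Type*} [NormedLieRing 𝔤] [NormedLieAlg 𝔤] [FiniteDimensional ℝ 𝔤]
  [NormedLieRing 𝔥] [NormedLieAlg 𝔥] [FiniteDimensional ℝ 𝔥]

/-- The bracket `(x, y) ↦ [x, y]` as a continuous bilinear map. -/
def bracketL (𝔤 : Type*) [NormedLieRing 𝔤] [NormedLieAlg 𝔤] [FiniteDimensional ℝ 𝔤] :
    𝔤 →L[ℝ] 𝔤 →L[ℝ] 𝔤 :=
  LinearMap.toContinuousBilinearMap
    (LinearMap.mk₂ ℝ (fun x y : 𝔤 => ⁅x, y⁆) add_lie smul_lie lie_add (fun c x y => lie_smul c x y))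

/-- The action `(x, y) ↦ dα(x)(y)` as a continuous bilinear map. -/
def DifferentialCrossedModule.actL (𝒞 : DifferentialCrossedModule 𝔤 𝔥) : 𝔤 →L[ℝ] 𝔥 →L[ℝ] 𝔥 :=
  LinearMap.toContinuousBilinearMap
    (LinearMap.mk₂ ℝ (fun (x : 𝔤) (y : 𝔥) => 𝒞.dα x y) (by simp) (by simp) (by simp) (by simp))

/-- `dt` as a continuous linear map. -/
def DifferentialCrossedModule.dtL (𝒞 : DifferentialCrossedModule 𝔤 𝔥) : 𝔥 →L[ℝ] 𝔤 :=
  LinearMap.toContinuousLinearMap (𝒞.dt : 𝔥 →ₗ[ℝ] 𝔤)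

end Bilinear

/-! ### Wedge product with a 1-form -/

section Wedge

variable {W V₁ V₂ V₃ : Type*} [NormedAddCommGroup W] [NormedSpace ℝ W]
  [NormedAddCommGroup V₁] [NormedSpace ℝ V₁] [NormedAddCommGroup V₂] [NormedSpace ℝ V₂]
  [NormedAddCommGroup V₃] [NormedSpace ℝ V₃]

/-- The wedge product `a ∧ η` of a 1-form `a` and a `k`-form `η`, where the values are multiplied
with the bilinear map `m`:
`(a ∧ η)(v₀, …, v_k) = ∑ i, (-1)^i m (a v_i) (η (v₀, …, v_{i-1}, v_{i+1}, …, v_k))`. -/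
def wedgeOne (m : V₁ →L[ℝ] V₂ →L[ℝ] V₃) {k : ℕ} (a : W [⋀^Fin 1]→L[ℝ] V₁)
    (η : W [⋀^Fin k]→L[ℝ] V₂) : W [⋀^Fin (k + 1)]→L[ℝ] V₃ :=
  ContinuousAlternatingMap.alternatizeUncurryFin
    (((ContinuousLinearMap.compContinuousAlternatingMapCLM ℝ W V₂ V₃ (Fin k)).flip η).comp
      (m.comp ((ContinuousAlternatingMap.ofSubsingleton ℝ W V₁ (0 : Fin 1)).symm a)))

theorem wedgeOne_apply (m : V₁ →L[ℝ] V₂ →L[ℝ] V₃) {k : ℕ} (a : W [⋀^Fin 1]→L[ℝ] V₁)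
    (η : W [⋀^Fin k]→L[ℝ] V₂) (v : Fin (k + 1) → W) :
    wedgeOne m a η v =
      ∑ i : Fin (k + 1), (-1) ^ (i : ℕ) • m (a fun _ => v i) (η (i.removeNth v)) := by
  simp [wedgeOne, ContinuousAlternatingMap.alternatizeUncurryFin_apply]

end Wedge

/-! ### Differential forms on a manifold -/

section Manifold

variable {E : Type*} [NormedAddCommGroup E] [NormedSpace ℝ E]
  {M : Type*} [TopologicalSpace M] [ChartedSpace E M]
  {V : Type*} [NormedAddCommGroup V] [NormedSpace ℝ V]
  {W : Type*} [NormedAddCommGroup W] [NormedSpace ℝ W]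

/-- A (not necessarily smooth) `V`-valued differential `k`-form on the manifold `M`: the value at
`x` is an alternating `k`-linear map on `TangentSpace 𝓘(ℝ, E) x`, whose underlying
vector space is by definition the model space `E`. -/
abbrev MForm (E M : Type*) [NormedAddCommGroup E] [NormedSpace ℝ E] [TopologicalSpace M]
    [ChartedSpace E M] (k : ℕ) (V : Type*) [NormedAddCommGroup V] [NormedSpace ℝ V] : Type _ :=
  M → E [⋀^Fin k]→L[ℝ] V

/-- The differential at `y` of a map `f : W → M` from a vector space to the manifold. -/
def tangentMapAt (f : W → M) (y : W) : W →L[ℝ] E :=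
  mfderiv 𝓘(ℝ, W) 𝓘(ℝ, E) f y

/-- The pullback `f^* η` of a form along a map `f : W → M`. -/
def MForm.pullback {k : ℕ} (η : MForm E M k V) (f : W → M) (y : W) : W [⋀^Fin k]→L[ℝ] V :=
  (η (f y)).compContinuousLinearMap (tangentMapAt f y)

/-- Smoothness of a form: in every chart its coordinate expression is smooth. -/
def MForm.IsSmooth {k : ℕ} (η : MForm E M k V) : Prop :=
  ∀ x₀ : M, ContDiffOn ℝ ∞ (η.pullback (extChartAt 𝓘(ℝ, E) x₀).symm)
    (extChartAt 𝓘(ℝ, E) x₀).target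

/-- The exterior derivative: computed in the chart at `x` and pulled back to `T_x M`. -/
def MForm.d {k : ℕ} (η : MForm E M k V) : MForm E M (k + 1) V := fun x =>
  (extDeriv (η.pullback (extChartAt 𝓘(ℝ, E) x).symm)
    (extChartAt 𝓘(ℝ, E) x x)).compContinuousLinearMap
      (mfderiv 𝓘(ℝ, E) 𝓘(ℝ, E) (extChartAt 𝓘(ℝ, E) x) x : E →L[ℝ] E)

/-- The gauge covariant exterior derivative `d_A η = dη + A^a ∧ dα(T_a)(η)`, for an action `ρ` in
the place of `dα`. -/
def MForm.covD {𝔤 : Type*} [NormedAddCommGroup 𝔤] [NormedSpace ℝ 𝔤] (ρ : 𝔤 →L[ℝ] V →L[ℝ] V)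
    {k : ℕ} (A : MForm E M 1 𝔤) (η : MForm E M k V) : MForm E M (k + 1) V :=
  fun x => η.d x + wedgeOne ρ (A x) (η x)

/-- The curvature `F_A = dA + (1/2) A^a ∧ A^b [T_a, T_b]`. -/
def MForm.curvature {𝔤 : Type*} [NormedLieRing 𝔤] [NormedLieAlg 𝔤] [FiniteDimensional ℝ 𝔤]
    (A : MForm E M 1 𝔤) : MForm E M 2 𝔤 :=
  fun x => A.d x + (1 / 2 : ℝ) • wedgeOne (bracketL 𝔤) (A x) (A x)

section CrossedModuleForms

variable {𝔤 𝔥 : Type*} [NormedLieRing 𝔤] [NormedLieAlg 𝔤] [FiniteDimensional ℝ 𝔤]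
  [NormedLieRing 𝔥] [NormedLieAlg 𝔥] [FiniteDimensional ℝ 𝔥]

/-- The fake curvature 2-form `F_A + dt(B)`. -/
def fakeCurvature (𝒞 : DifferentialCrossedModule 𝔤 𝔥) (A : MForm E M 1 𝔤)
    (B : MForm E M 2 𝔥) : MForm E M 2 𝔤 :=
  fun x => A.curvature x + 𝒞.dtL.compContinuousAlternatingMap (B x)

/-- The curvature 3-form `H = d_A B`. -/
def curvature3Form (𝒞 : DifferentialCrossedModule 𝔤 𝔥) (A : MForm E M 1 𝔤)
    (B : MForm E M 2 𝔥) : MForm E M 3 𝔥 :=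
  MForm.covD 𝒞.actL A B

end CrossedModuleForms

/-! ### Based path space as a diffeological space -/

/-- The based parametrized path space: smooth maps `[0,1] → M` from `s` to `t` which are constant
in a neighbourhood of `0` and in a neighbourhood of `1`. Such a map is represented by its smooth
extension to `ℝ` that is constant to the left of `0` and to the right of `1`. -/
structure SmoothPath (E : Type*) {M : Type*} [NormedAddCommGroup E] [NormedSpace ℝ E]
    [TopologicalSpace M] [ChartedSpace E M] (s t : M) where
  toFun : ℝ → M
  smooth : ContMDiff 𝓘(ℝ, ℝ) 𝓘(ℝ, E) ∞ toFun
  sitting : ∃ ε > 0, (∀ σ ≤ ε, toFun σ = s) ∧ (∀ σ ≥ 1 - ε, toFun σ = t)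

instance (s t : M) : CoeFun (SmoothPath E s t) (fun _ => ℝ → M) := ⟨SmoothPath.toFun⟩

/-- The smooth structure of path space: a family `u ↦ p u` of paths, `u ∈ ℝⁿ`, is smooth (a plot)
if `(u, σ) ↦ p u σ` is smooth. -/
instance (s t : M) : DiffeologicalSpace (SmoothPath E s t) :=
  .ofCorePlotsOn
    { isPlotOn := fun {n u} _ p =>
        ContMDiffOn 𝓘(ℝ, EuclideanSpace ℝ (Fin n) × ℝ) 𝓘(ℝ, E) ∞
          (fun q : EuclideanSpace ℝ (Fin n) × ℝ => p q.1 q.2) (u ×ˢ univ)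
      isPlotOn_congr := fun _ _ _ h =>
        contMDiffOn_congr fun q hq => by simp [h hq.1]
      isPlot := fun {n} p =>
        ContMDiff 𝓘(ℝ, EuclideanSpace ℝ (Fin n) × ℝ) 𝓘(ℝ, E) ∞
          (fun q : EuclideanSpace ℝ (Fin n) × ℝ => p q.1 q.2)
      isPlotOn_univ := by
        intro n p
        rw [univ_prod_univ, contMDiffOn_univ]
      isPlot_const := fun γ => γ.smooth.comp contDiff_snd.contMDiff
      isPlotOn_reparam := fun {n m u v _} _ {p f} h hp hf => by
        have hg : ContMDiffOn 𝓘(ℝ, EuclideanSpace ℝ (Fin m) × ℝ)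
            𝓘(ℝ, EuclideanSpace ℝ (Fin n) × ℝ) ∞
            (fun q : EuclideanSpace ℝ (Fin m) × ℝ => (f q.1, q.2)) (v ×ˢ univ) := by
          rw [contMDiffOn_iff_contDiffOn]
          exact (hf.comp contDiff_fst.contDiffOn (fun q hq => hq.1)).prodMk
            contDiff_snd.contDiffOn
        exact hp.comp hg (fun q hq => ⟨h hq.1, mem_univ _⟩)
      locality := fun {n u} hu p h => by
        rintro ⟨x, σ⟩ ⟨hx, -⟩
        obtain ⟨v, hv, hxv, hpv⟩ := h x hx
        exact ((hpv (x, σ) ⟨hxv, mem_univ _⟩).contMDiffAt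
          ((hv.prod isOpen_univ).mem_nhds ⟨hxv, mem_univ _⟩)).contMDiffWithinAt }

theorem isPlot_iff {s t : M} {n : ℕ} {p : EuclideanSpace ℝ (Fin n) → SmoothPath E s t} :
    IsPlot p ↔ ContMDiff 𝓘(ℝ, EuclideanSpace ℝ (Fin n) × ℝ) 𝓘(ℝ, E) ∞
      (fun q : EuclideanSpace ℝ (Fin n) × ℝ => p q.1 q.2) :=
  Iff.rfl

end Manifold

/-! ### Differential forms on a diffeological space -/

section PlotForms

/-- The plots of a diffeological space with domain `ℝⁿ`. -/
abbrev Plot (n : ℕ) (X : Type*) [DiffeologicalSpace X] : Type _ :=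
  {p : EuclideanSpace ℝ (Fin n) → X // IsPlot p}

variable {X : Type*} [DiffeologicalSpace X] {V : Type*} [NormedAddCommGroup V] [NormedSpace ℝ V]

/-- Families `η` which assign to every plot `p : ℝⁿ → X` a (not necessarily smooth) `k`-form
`p^* η` on `ℝⁿ`. A differential form on `X` is such a family satisfying
`PlotForm.IsDifferentialForm`. -/
abbrev PlotForm (X : Type*) [DiffeologicalSpace X] (k : ℕ) (V : Type*) [NormedAddCommGroup V]
    [NormedSpace ℝ V] : Type _ :=
  ∀ n : ℕ, Plot n X → EuclideanSpace ℝ (Fin n) → EuclideanSpace ℝ (Fin n) [⋀^Fin k]→L[ℝ] V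

/-- A differential form on a diffeological space: smooth on each plot, and compatible with smooth
changes of the parameters, `(p ∘ f)^* η = f^* (p^* η)`. -/
structure PlotForm.IsDifferentialForm {k : ℕ} (η : PlotForm X k V) : Prop where
  smooth : ∀ (n : ℕ) (p : Plot n X), ContDiff ℝ ∞ (η n p)
  compatible : ∀ (m n : ℕ) (p : Plot n X)
    (f : EuclideanSpace ℝ (Fin m) → EuclideanSpace ℝ (Fin n)) (hf : ContDiff ℝ ∞ f)
    (u : EuclideanSpace ℝ (Fin m)),
    η m ⟨p.1 ∘ f, isPlot_reparam p.2 hf⟩ u = (η n p (f u)).compContinuousLinearMap (fderiv ℝ f u)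

/-- The exterior derivative, `p^* (dη) = d (p^* η)`. -/
def PlotForm.d {k : ℕ} (η : PlotForm X k V) : PlotForm X (k + 1) V :=
  fun n p u => extDeriv (η n p) u

/-- The curvature `d𝒜 + 𝒜 ∧ 𝒜` of a Lie algebra valued 1-form, where
`𝒜 ∧ 𝒜 = (1/2) 𝒜^a ∧ 𝒜^b [S_a, S_b]`, that is `(𝒜 ∧ 𝒜)(v, w) = [𝒜 v, 𝒜 w]`. -/
def PlotForm.curvature {𝔥 : Type*} [NormedLieRing 𝔥] [NormedLieAlg 𝔥] [FiniteDimensional ℝ 𝔥]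
    (𝒜 : PlotForm X 1 𝔥) : PlotForm X 2 𝔥 :=
  fun n p u => 𝒜.d n p u + (1 / 2 : ℝ) • wedgeOne (bracketL 𝔥) (𝒜 n p u) (𝒜 n p u)

end PlotForms

/-! ### Parallel transport and Chen forms -/

section Chen

variable {E : Type*} [NormedAddCommGroup E] [NormedSpace ℝ E]
  {M : Type*} [TopologicalSpace M] [ChartedSpace E M]
  {𝔤 V : Type*} [NormedAddCommGroup 𝔤] [NormedSpace ℝ 𝔤] [NormedAddCommGroup V] [NormedSpace ℝ V]
  {s t : M}

/-- The tangent vector `X'(σ)` of a path. -/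
def SmoothPath.velocity (γ : SmoothPath E s t) (σ : ℝ) : E :=
  tangentMapAt (γ : ℝ → M) σ 1

/-- The `N`-th term of the parallel transport series from `σ` to `1` for the action `ρ` of `𝔤` on
`V`: the iterated integral over `σ < σ₁ < ⋯ < σ_N < 1` of
`ρ(-A(X'(σ_N))) ∘ ⋯ ∘ ρ(-A(X'(σ₁)))`, the innermost integration variable being `σ_N`. -/
def transportTerm (ρ : 𝔤 →L[ℝ] V →L[ℝ] V) (A : MForm E M 1 𝔤) (γ : SmoothPath E s t) :
    ℕ → ℝ → (V →L[ℝ] V)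
  | 0, _ => ContinuousLinearMap.id ℝ V
  | N + 1, σ => ∫ σ₁ in σ..1,
      (transportTerm ρ A γ N σ₁).comp (ρ (-(A (γ σ₁) fun _ => γ.velocity σ₁)))

/-- Parallel transport `W_A[X](σ, 1)` from the parameter value `σ` to `1`, acting on `V`. -/
def transport (ρ : 𝔤 →L[ℝ] V →L[ℝ] V) (A : MForm E M 1 𝔤) (γ : SmoothPath E s t) (σ : ℝ) :
    V →L[ℝ] V :=
  ∑' N : ℕ, transportTerm ρ A γ N σ

/-- The contraction `ι_K η(σ)` of the pulled back form `η(σ) = e_σ^* η` with the vector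
field `K(X) = X'`, evaluated on the plot `p` at `u`:
`(v₁, …, v_k) ↦ η(X'(σ), ∂_{v₁} X(σ), …, ∂_{v_k} X(σ))` for `X = p u`. -/
def contractedEval {k n : ℕ} (η : MForm E M (k + 1) V) (p : Plot n (SmoothPath E s t))
    (u : EuclideanSpace ℝ (Fin n)) (σ : ℝ) : EuclideanSpace ℝ (Fin n) [⋀^Fin k]→L[ℝ] V :=
  ((η (p.1 u σ)).curryLeft ((p.1 u).velocity σ)).compContinuousLinearMap
    (tangentMapAt (fun w => p.1 w σ) u)

/-- `ι_K η^{W_A}(σ)`: the contraction `ι_K η(σ)` parallel transported to the end of the path. -/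
def transportedEval (ρ : 𝔤 →L[ℝ] V →L[ℝ] V) (A : MForm E M 1 𝔤) {k n : ℕ}
    (η : MForm E M (k + 1) V) (p : Plot n (SmoothPath E s t)) (u : EuclideanSpace ℝ (Fin n))
    (σ : ℝ) : EuclideanSpace ℝ (Fin n) [⋀^Fin k]→L[ℝ] V :=
  (transport ρ A (p.1 u) σ).compContinuousAlternatingMap (contractedEval η p u σ)

/-- The Chen form `∮_A(η)`: the integral of `ι_K η^{W_A}(σ)` over `0 < σ < 1`. -/
def chen (ρ : 𝔤 →L[ℝ] V →L[ℝ] V) (A : MForm E M 1 𝔤) (s t : M) {k : ℕ}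
    (η : MForm E M (k + 1) V) : PlotForm (SmoothPath E s t) k V :=
  fun _ p u => ∫ σ in (0 : ℝ)..1, transportedEval ρ A η p u σ

/-- The parallel transport series and the integrands entering the Chen forms built from `η` are
well behaved: the series converges, and `σ ↦ ι_K η^{W_A}(σ)` is continuous on `[0,1]`. -/
structure ChenConvergent (ρ : 𝔤 →L[ℝ] V →L[ℝ] V) (A : MForm E M 1 𝔤) (s t : M) {k : ℕ}
    (η : MForm E M (k + 1) V) : Prop where
  summable : ∀ (γ : SmoothPath E s t), ∀ σ ∈ Icc (0 : ℝ) 1,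
    Summable fun N : ℕ => transportTerm ρ A γ N σ
  continuousOn : ∀ (n : ℕ) (p : Plot n (SmoothPath E s t)) (u : EuclideanSpace ℝ (Fin n)),
    ContinuousOn (transportedEval ρ A η p u) (Icc (0 : ℝ) 1)

end Chen

section Connection

variable {E : Type*} [NormedAddCommGroup E] [NormedSpace ℝ E]
  {M : Type*} [TopologicalSpace M] [ChartedSpace E M]
  {𝔤 𝔥 : Type*} [NormedLieRing 𝔤] [NormedLieAlg 𝔤] [FiniteDimensional ℝ 𝔤]
  [NormedLieRing 𝔥] [NormedLieAlg 𝔥] [FiniteDimensional ℝ 𝔥]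

/-- The Chen form `∮_A(dα(T_a)(B), Φ^a)`: the integral over `0 < σ₁ < σ₂ < 1` of
`dα(T_a)(ι_K B^{W_A}(σ₁)) ∧ (ι_K Φ^{W_A}(σ₂))^a`. The sum over a basis `T_a` of `𝔤` is expressed
through the bilinear map `(y, x) ↦ ∑ a, x^a dα(T_a)(y) = dα(x)(y)`; the Lie algebra index refers
to the transported forms, which live at the end point of the path. -/
def chenAct (𝒞 : DifferentialCrossedModule 𝔤 𝔥) (A : MForm E M 1 𝔤) (s t : M)
    (B : MForm E M 2 𝔥) (Φ : MForm E M 2 𝔤) : PlotForm (SmoothPath E s t) 2 𝔥 :=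
  fun _ p u => ∫ σ₂ in (0 : ℝ)..1, ∫ σ₁ in (0 : ℝ)..σ₂,
    wedgeOne 𝒞.actL.flip (transportedEval 𝒞.actL A B p u σ₁)
      (transportedEval (bracketL 𝔤) A Φ p u σ₂)

/-- The standard connection 1-form on path space, `𝒜 = ∮_A(B)`. -/
def standardConnection (𝒞 : DifferentialCrossedModule 𝔤 𝔥) (A : MForm E M 1 𝔤)
    (B : MForm E M 2 𝔥) (s t : M) : PlotForm (SmoothPath E s t) 1 𝔥 :=
  chen 𝒞.actL A s t B

end Connection

end PathCurvature

end

/-! A plot turns the theorem into a computation on ℝⁿ × ℝ: all forms on `M` are pulled back along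
(u, σ) ↦ X_u(σ), where K becomes ∂_σ and a variation v of the path becomes (v, 0). Write W(σ) and
G(σ) for the transports from σ to 1 on 𝔥 and 𝔤. Both solve a linear equation S' = S a with S(1) = 1,
so the series converge, depend smoothly on (u, σ), and have invertible values.

The variation of the transport is ∂_v W(σ) = W(σ) dα(A(v)) + (∫_σ^1 dα(G F_A(K, v)) dτ) W(σ). It
comes from Duhamel's formula and one integration by parts, using W dα(y) W⁻¹ = dα(G y)
(`picardSum_actL_conj`) and A(v) = 0 at the fixed end point (`fderiv_picardSum_actL`).

Insert this in d𝒜(v, w) with 𝒜(v) = ∫ W B(K, v). The local terms form -∫ W (d_A B)(K, v, w) plus the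
integral of ∂_σ(W B(v, w)), which vanishes because both end points are fixed. The nonlocal terms are
double integrals over a triangle containing F_A. Finally 𝒜 ∧ 𝒜 is a bracket of two integrals;
cutting the square into two triangles and using dα(dt y) = [y, ·] and dt W = G dt, it supplies
exactly the dt(B) that completes F_A to the fake curvature. This is `curvature_identity`; what
remains is analysis (smooth dependence of the transport) and translation between forms and
functions. -/

noncomputable section

namespace PathCurvature

/-! ### The linear equation S' = S a, S(1) = 1, solved by its Picard series -/

section LinearODE

variable {R : Type*} [NormedRing R] [NormedAlgebra ℝ R]

/-- The terms of the Picard series of the linear equation `S' = S a`, `S 1 = 1`. -/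
def picardTerm (a : ℝ → R) : ℕ → ℝ → R
  | 0, _ => 1
  | N + 1, σ => ∫ τ in σ..1, picardTerm a N τ * -a τ

/-- The sum of the Picard series of the linear equation `S' = S a`, `S 1 = 1`. -/
def picardSum (a : ℝ → R) (σ : ℝ) : R := ∑' N : ℕ, picardTerm a N σ

theorem continuous_picardTerm_uncurry {P : Type*} [TopologicalSpace P] [FirstCountableTopology P]
    {a : P × ℝ → R} (ha : Continuous a) (N : ℕ) :
    Continuous fun q : P × ℝ => picardTerm (fun τ => a (q.1, τ)) N q.2 := by
  induction N with
  | zero => exact continuous_const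
  | succ N ih =>
    have h : Continuous (fun q : P × ℝ =>
        ∫ τ in (1 : ℝ)..q.2, picardTerm (fun τ => a (q.1, τ)) N τ * -a (q.1, τ)) := by
      refine intervalIntegral.continuous_parametric_intervalIntegral_of_continuous
        (f := fun (q : P × ℝ) τ => picardTerm (fun τ => a (q.1, τ)) N τ * -a (q.1, τ)) ?_
        continuous_snd
      have h1 : Continuous fun r : (P × ℝ) × ℝ => ((r.1.1, r.2) : P × ℝ) := by fun_prop
      exact (ih.comp h1).mul (ha.comp h1).neg
    simp only [picardTerm, intervalIntegral.integral_symm (1 : ℝ)]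
    exact h.neg

theorem continuous_picardTerm {a : ℝ → R} (ha : Continuous a) (N : ℕ) :
    Continuous (picardTerm a N) :=
  (continuous_picardTerm_uncurry (P := Unit) (a := fun q => a q.2) (by fun_prop) N).comp
    (by fun_prop : Continuous fun σ : ℝ => (((), σ) : Unit × ℝ))

/-- The N! is the volume factor of the simplex of iterated integration. The factor ‖1‖ stays because
it need not be 1: it is 0 for endomorphisms of the zero space. -/
theorem norm_picardTerm_le {a : ℝ → R} {s C : ℝ} (hC : ∀ τ ∈ uIcc s 1, ‖a τ‖ ≤ C) (N : ℕ) :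
    ∀ σ ∈ uIcc s 1, ‖picardTerm a N σ‖ ≤ ‖(1 : R)‖ * ((C * |σ - 1|) ^ N / N.factorial) := by
  have hC0 : 0 ≤ C := (norm_nonneg _).trans (hC 1 right_mem_uIcc)
  induction N with
  | zero => intro σ _; simp [picardTerm]
  | succ N ih =>
    intro σ hσ
    have hsub : uIoc 1 σ ⊆ uIcc s 1 := by
      rw [uIoc_comm]
      exact uIoc_subset_uIcc.trans (uIcc_subset_uIcc hσ right_mem_uIcc)
    have h1 : ‖picardTerm a (N + 1) σ‖ ≤
        |∫ τ in (1 : ℝ)..σ, (‖(1 : R)‖ * C ^ (N + 1) / N.factorial) * |τ - 1| ^ N| := by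
      rw [picardTerm, intervalIntegral.integral_symm, norm_neg]
      refine intervalIntegral.norm_integral_le_abs_of_norm_le ?_ ?_
      · refine (MeasureTheory.ae_restrict_mem measurableSet_uIoc).mono fun τ hτ => ?_
        calc ‖picardTerm a N τ * -a τ‖ ≤ ‖picardTerm a N τ‖ * ‖a τ‖ := by
              simpa using norm_mul_le (picardTerm a N τ) (-a τ)
          _ ≤ (‖(1 : R)‖ * ((C * |τ - 1|) ^ N / N.factorial)) * C := by
              gcongr
              · exact ih τ (hsub hτ)
              · exact hC τ (hsub hτ)
          _ = _ := by rw [mul_pow]; ring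
      · exact (by fun_prop : Continuous fun τ : ℝ =>
          (‖(1 : R)‖ * C ^ (N + 1) / N.factorial) * |τ - 1| ^ N).intervalIntegrable _ _
    refine h1.trans (le_of_eq ?_)
    rw [intervalIntegral.abs_intervalIntegral_eq, MeasureTheory.integral_const_mul,
      integral_pow_abs_sub_uIoc, abs_of_nonneg (by positivity), Nat.factorial_succ]
    push_cast
    field_simp
    ring

theorem summable_picard_bound (K x : ℝ) :
    Summable fun N : ℕ => K * (x ^ N / N.factorial) :=
  (Real.summable_pow_div_factorial x).mul_left K

theorem exists_norm_le_of_continuous {X V : Type*} [TopologicalSpace X] [NormedAddCommGroup V]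
    {f : X → V} (hf : Continuous f) {K : Set X} (hK : IsCompact K) : ∃ C, ∀ x ∈ K, ‖f x‖ ≤ C :=
  hK.exists_bound_of_continuousOn hf.continuousOn

variable [CompleteSpace R]

theorem summable_picardTerm {a : ℝ → R} (ha : Continuous a) (σ : ℝ) :
    Summable fun N => picardTerm a N σ := by
  obtain ⟨C, hC⟩ := exists_norm_le_of_continuous ha (isCompact_uIcc (a := σ) (b := 1))
  exact .of_norm_bounded (summable_picard_bound _ _)
    fun N => norm_picardTerm_le hC N σ left_mem_uIcc

theorem continuous_picardSum_uncurry {P : Type*} [TopologicalSpace P] [FirstCountableTopology P]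
    [LocallyCompactSpace P] {a : P × ℝ → R} (ha : Continuous a) :
    Continuous fun q : P × ℝ => picardSum (fun τ => a (q.1, τ)) q.2 := by
  rw [continuous_iff_continuousAt]
  rintro ⟨u, σ⟩
  obtain ⟨K, hK, hKu⟩ := exists_compact_mem_nhds u
  -- The neighbourhood of σ is a ball about 1, so that it contains the whole segment from τ to 1 on
  -- which the iterated integrals live; a single bound C for `a` then serves all nearby points.
  obtain ⟨L, hL, hL1⟩ : ∃ L : ℝ, 1 ≤ L ∧ |σ - 1| < L :=
    ⟨|σ - 1| + 1, by linarith [abs_nonneg (σ - 1)], by linarith⟩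
  obtain ⟨C, hC⟩ := exists_norm_le_of_continuous ha
    (hK.prod (isCompact_Icc (a := 1 - L) (b := 1 + L)))
  have hn : K ×ˢ Metric.ball (1 : ℝ) L ∈ 𝓝 (u, σ) :=
    prod_mem_nhds hKu (Metric.isOpen_ball.mem_nhds (by simpa [Real.dist_eq] using hL1))
  refine ContinuousOn.continuousAt (s := K ×ˢ Metric.ball (1 : ℝ) L) ?_ hn
  refine continuousOn_tsum (u := fun N : ℕ => ‖(1 : R)‖ * ((C * L) ^ N / N.factorial))
    (fun N => (continuous_picardTerm_uncurry ha N).continuousOn) (summable_picard_bound _ _) ?_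
  rintro N ⟨v, τ⟩ ⟨hv, hτ⟩
  have hτ' : |τ - 1| < L := by simpa [Real.dist_eq] using hτ
  have hsub : uIcc τ 1 ⊆ Icc (1 - L) (1 + L) := by
    rw [abs_lt] at hτ'
    exact uIcc_subset_Icc ⟨by linarith, by linarith⟩ ⟨by linarith, by linarith⟩
  have hC' : ∀ r ∈ uIcc τ 1, ‖a (v, r)‖ ≤ C := fun r hr => hC (v, r) ⟨hv, hsub hr⟩
  have hC0 : 0 ≤ C := (norm_nonneg _).trans (hC' τ left_mem_uIcc)
  refine (norm_picardTerm_le hC' N τ left_mem_uIcc).trans ?_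
  gcongr

theorem continuous_picardSum {a : ℝ → R} (ha : Continuous a) : Continuous (picardSum a) :=
  (continuous_picardSum_uncurry (P := Unit) (a := fun q => a q.2) (by fun_prop)).comp
    (by fun_prop : Continuous fun σ : ℝ => (((), σ) : Unit × ℝ))

/-- Integrating the series term by term, dominated by an exponential series, shifts the index by
one; the missing term N = 0 is the constant 1. -/
theorem picardSum_eq {a : ℝ → R} (ha : Continuous a) (σ : ℝ) :
    picardSum a σ = 1 + ∫ τ in σ..1, picardSum a τ * -a τ := by
  obtain ⟨C, hC⟩ := exists_norm_le_of_continuous ha (isCompact_uIcc (a := σ) (b := 1))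
  have hC0 : 0 ≤ C := (norm_nonneg _).trans (hC 1 right_mem_uIcc)
  have h := intervalIntegral.hasSum_integral_of_dominated_convergence (a := σ) (b := 1)
    (μ := MeasureTheory.volume) (F := fun N τ => picardTerm a N τ * -a τ)
    (f := fun τ => picardSum a τ * -a τ)
    (fun N _ => (‖(1 : R)‖ * ((C * |σ - 1|) ^ N / N.factorial)) * C)
    (fun N => ((continuous_picardTerm ha N).mul ha.neg).aestronglyMeasurable)
    (fun N => .of_forall fun τ hτ => ?_)
    (.of_forall fun τ _ => (summable_picard_bound _ _).mul_right _)
    intervalIntegrable_const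
    (.of_forall fun τ _ => (summable_picardTerm ha τ).hasSum.mul_right _)
  · have h2 := (hasSum_nat_add_iff (f := fun N => picardTerm a N σ) 1).mp h
    rw [picardSum, h2.tsum_eq]
    simp [picardTerm, add_comm]
  · have hτ' := uIoc_subset_uIcc hτ
    have hle : |τ - 1| ≤ |σ - 1| := by
      have := abs_sub_right_of_mem_uIcc hτ'
      rwa [abs_sub_comm, abs_sub_comm σ]
    calc ‖picardTerm a N τ * -a τ‖ ≤ ‖picardTerm a N τ‖ * ‖a τ‖ := by
          simpa using norm_mul_le (picardTerm a N τ) (-a τ)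
      _ ≤ (‖(1 : R)‖ * ((C * |τ - 1|) ^ N / N.factorial)) * C := by
          gcongr
          · exact norm_picardTerm_le hC N τ hτ'
          · exact hC τ hτ'
      _ ≤ _ := by gcongr

theorem picardSum_one {a : ℝ → R} (ha : Continuous a) : picardSum a 1 = 1 := by
  simp [picardSum_eq ha 1]

theorem hasDerivAt_picardSum {a : ℝ → R} (ha : Continuous a) (σ : ℝ) :
    HasDerivAt (picardSum a) (picardSum a σ * a σ) σ := by
  have hc : Continuous fun τ => picardSum a τ * a τ := (continuous_picardSum ha).mul ha
  have h := (intervalIntegral.integral_hasDerivAt_right (hc.intervalIntegrable 1 σ)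
    (hc.stronglyMeasurableAtFilter _ _) hc.continuousAt).const_add (1 : R)
  refine h.congr_of_eventuallyEq (.of_forall fun τ => ?_)
  rw [picardSum_eq ha τ, intervalIntegral.integral_symm]
  simp

/-- The candidate inverse U solves U' = -a U with U(1) = 1. This is the same kind of equation with
the factors in reverse order, hence the Picard series over the opposite ring. The product S U has
derivative S a U - S a U = 0. -/
theorem isUnit_picardSum [FiniteDimensional ℝ R] {a : ℝ → R} (ha : Continuous a) (σ : ℝ) :
    IsUnit (picardSum a σ) := by
  have hb : Continuous fun τ => MulOpposite.op (-a τ) := MulOpposite.continuous_op.comp ha.neg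
  set U : ℝ → R := fun τ => (picardSum (fun τ => MulOpposite.op (-a τ)) τ).unop with hU
  have hUd : ∀ τ, HasDerivAt U (-a τ * U τ) τ := fun τ => by
    exact (MulOpposite.opContinuousLinearEquiv ℝ (M := R)).symm.toContinuousLinearMap
      |>.hasFDerivAt.comp_hasDerivAt τ (hasDerivAt_picardSum hb τ)
  have hd : ∀ τ, HasDerivAt (fun τ => picardSum a τ * U τ) 0 τ := fun τ => by
    refine ((hasDerivAt_picardSum ha τ).mul (hUd τ)).congr_deriv ?_
    rw [mul_assoc]
    simp
  have h1 : picardSum a σ * U σ = picardSum a 1 * U 1 :=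
    is_const_of_deriv_eq_zero (fun τ => (hd τ).differentiableAt) (fun τ => (hd τ).deriv) σ 1
  rw [picardSum_one ha, hU] at h1
  simp only [picardSum_one hb, MulOpposite.unop_one, mul_one] at h1
  -- In a Noetherian ring a one-sided inverse is two-sided.
  have : IsNoetherianRing R := isNoetherian_of_tower ℝ inferInstance
  exact .of_mul_eq_one _ h1

end LinearODE

/-! ### Smoothness of integrals depending on parameters -/

section ParametricIntegral

variable {P V : Type*} [NormedAddCommGroup P] [NormedSpace ℝ P]
  [NormedAddCommGroup V] [NormedSpace ℝ V]

theorem hasFDerivAt_comp_prodMk_left {F : P × ℝ → V} {q : P × ℝ} (hF : DifferentiableAt ℝ F q) :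
    HasFDerivAt (fun w => F (w, q.2)) ((fderiv ℝ F q).comp (.inl ℝ P ℝ)) q.1 :=
  hF.hasFDerivAt.comp q.1 (hasFDerivAt_prodMk_left q.1 q.2)

variable [FiniteDimensional ℝ P]

theorem hasFDerivAt_intervalIntegral_of_continuous {F : P → ℝ → V} {F' : P → ℝ → P →L[ℝ] V}
    (hF : Continuous fun q : P × ℝ => F q.1 q.2) (hF' : Continuous fun q : P × ℝ => F' q.1 q.2)
    (h : ∀ u τ, HasFDerivAt (fun w => F w τ) (F' u τ) u) (a b : ℝ) (u : P) :
    HasFDerivAt (fun w => ∫ τ in a..b, F w τ) (∫ τ in a..b, F' u τ) u := by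
  have : ProperSpace P := FiniteDimensional.proper ℝ P
  have hFc : ∀ w, Continuous (F w) := fun w => hF.comp (by fun_prop : Continuous fun τ => (w, τ))
  have hFc' : Continuous (F' u) := hF'.comp (by fun_prop : Continuous fun τ => (u, τ))
  obtain ⟨C, hC⟩ := exists_norm_le_of_continuous hF'
    ((isCompact_closedBall u 1).prod (isCompact_uIcc (a := a) (b := b)))
  refine intervalIntegral.hasFDerivAt_integral_of_dominated_of_fderiv_le (F' := F')
    (s := Metric.closedBall u 1) (bound := fun _ => C) (Metric.closedBall_mem_nhds u one_pos)
    (.of_forall fun w => (hFc w).aestronglyMeasurable) ((hFc u).intervalIntegrable _ _)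
    hFc'.aestronglyMeasurable
    (.of_forall fun τ hτ w hw => hC (w, τ) ⟨hw, uIoc_subset_uIcc hτ⟩)
    intervalIntegrable_const (.of_forall fun τ _ w _ => h w τ)

theorem hasFDerivAt_intervalIntegral_of_contDiff {F : P × ℝ → V} (hF : ContDiff ℝ 1 F)
    (a b : ℝ) (u : P) :
    HasFDerivAt (fun w => ∫ τ in a..b, F (w, τ))
      (∫ τ in a..b, (fderiv ℝ F (u, τ)).comp (.inl ℝ P ℝ)) u :=
  hasFDerivAt_intervalIntegral_of_continuous (F := fun w τ => F (w, τ))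
    (F' := fun w τ => (fderiv ℝ F (w, τ)).comp (.inl ℝ P ℝ)) hF.continuous
    ((hF.continuous_fderiv one_ne_zero).clm_comp continuous_const)
    (fun w τ => hasFDerivAt_comp_prodMk_left (hF.differentiable one_ne_zero (w, τ))) a b u

theorem fderiv_intervalIntegral_apply {F : P × ℝ → V} (hF : ContDiff ℝ 1 F)
    (a b : ℝ) (u v : P) [CompleteSpace V] :
    fderiv ℝ (fun w => ∫ τ in a..b, F (w, τ)) u v =
      ∫ τ in a..b, fderiv ℝ F (u, τ) (v, 0) := by
  rw [(hasFDerivAt_intervalIntegral_of_contDiff hF a b u).fderiv,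
    ContinuousLinearMap.intervalIntegral_apply]
  · simp
  · refine Continuous.intervalIntegrable ?_ _ _
    exact ((hF.continuous_fderiv one_ne_zero).comp
      (by fun_prop : Continuous fun τ : ℝ => (u, τ))).clm_comp continuous_const

/-- Induction on the order: the derivative in a fixed direction is again a parametric integral, of
an integrand with one derivative less. -/
theorem contDiff_intervalIntegral_nat [CompleteSpace V] (n : ℕ) :
    ∀ {F : P × ℝ → V}, ContDiff ℝ n F → ∀ a b : ℝ, ContDiff ℝ n fun w => ∫ τ in a..b, F (w, τ) := by
  induction n with
  | zero =>
    intro F hF a b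
    simp only [Nat.cast_zero, contDiff_zero] at hF ⊢
    exact intervalIntegral.continuous_parametric_intervalIntegral_of_continuous'
      (f := fun w τ => F (w, τ)) hF a b
  | succ n ih =>
    intro F hF a b
    have h1 : ContDiff ℝ 1 F := hF.of_le (by simp)
    push_cast at hF ⊢
    refine contDiff_succ_iff_fderiv_apply.mpr
      ⟨fun u => (hasFDerivAt_intervalIntegral_of_contDiff h1 a b u).differentiableAt, by simp,
        fun v => ?_⟩
    simp only [fderiv_intervalIntegral_apply h1]
    exact ih (((contDiff_succ_iff_fderiv.mp hF).2.2).clm_apply contDiff_const) a b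

theorem contDiff_intervalIntegral [CompleteSpace V] {n : ℕ∞} {F : P × ℝ → V} (hF : ContDiff ℝ n F)
    (a b : ℝ) : ContDiff ℝ n fun w => ∫ τ in a..b, F (w, τ) := by
  rw [contDiff_iff_forall_nat_le]
  exact fun m hm => contDiff_intervalIntegral_nat m (hF.of_le (mod_cast hm)) a b

/-- An affine substitution moves the integral to [0, 1], so that the bounds become parameters of the
integrand. -/
theorem contDiff_intervalIntegral_of_bounds [CompleteSpace V] {n : ℕ∞} {F : P × ℝ → V}
    (hF : ContDiff ℝ n F) {f g : P → ℝ} (hf : ContDiff ℝ n f) (hg : ContDiff ℝ n g) :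
    ContDiff ℝ n fun w => ∫ τ in f w..g w, F (w, τ) := by
  have h : (fun w => ∫ τ in f w..g w, F (w, τ)) =
      fun w => (g w - f w) • ∫ r in (0 : ℝ)..1, F (w, f w + (g w - f w) * r) := by
    funext w
    rw [intervalIntegral.smul_integral_comp_add_mul (fun τ => F (w, τ))]
    simp
  rw [h]
  refine (hg.sub hf).smul (contDiff_intervalIntegral
    (F := fun q : P × ℝ => F (q.1, f q.1 + (g q.1 - f q.1) * q.2)) (hF.comp ?_) 0 1)
  have hf' : ContDiff ℝ n fun q : P × ℝ => f q.1 := hf.comp contDiff_fst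
  have hg' : ContDiff ℝ n fun q : P × ℝ => g q.1 := hg.comp contDiff_fst
  exact contDiff_fst.prodMk (hf'.add ((hg'.sub hf').mul contDiff_snd))

end ParametricIntegral

/-! ### Smooth dependence of the Picard series on parameters -/

section SmoothDependence

variable {R : Type*} [NormedRing R] [NormedAlgebra ℝ R]

/-- A product rule in which f need not be differentiable: its derivative would be multiplied by g(u)
= 0, and the error (f w - f u) g w is o(1) · O(w - u). -/
theorem HasFDerivAt.mul_of_continuousAt_of_eq_zero {P : Type*} [NormedAddCommGroup P]
    [NormedSpace ℝ P] {f g : P → R} {g' : P →L[ℝ] R} {u : P} (hf : ContinuousAt f u)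
    (hg : HasFDerivAt g g' u) (h0 : g u = 0) :
    HasFDerivAt (fun w => f w * g w) ((ContinuousLinearMap.mul ℝ R (f u)).comp g') u := by
  have h1 : (fun w => (f w - f u) * g w) =o[𝓝 u] fun w => w - u := by
    have hf0 : (fun w => f w - f u) =o[𝓝 u] fun _ => (1 : ℝ) := by
      rw [Asymptotics.isLittleO_one_iff]
      simpa using hf.sub_const (f u)
    have hg0 : g =O[𝓝 u] fun w => w - u := by simpa [h0] using hg.isBigO_sub
    simpa using hf0.norm_right.mul_isBigO hg0.norm_right
  have h2 := (ContinuousLinearMap.mul ℝ R (f u)).hasFDerivAt.comp u hg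
  rw [hasFDerivAt_iff_isLittleO] at h2 ⊢
  refine (h1.add h2).congr_left fun w => ?_
  simp [h0, sub_mul]

/-- The inverse of the Picard series. -/
def picardInv (a : ℝ → R) (σ : ℝ) : R := Ring.inverse (picardSum a σ)

variable [CompleteSpace R]

theorem picardInv_one {a : ℝ → R} (ha : Continuous a) : picardInv a 1 = 1 := by
  rw [picardInv, picardSum_one ha, Ring.inverse_one]

variable [FiniteDimensional ℝ R]

theorem picardInv_mul_picardSum {a : ℝ → R} (ha : Continuous a) (σ : ℝ) :
    picardInv a σ * picardSum a σ = 1 :=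
  Ring.inverse_mul_cancel _ (isUnit_picardSum ha σ)

theorem contDiff_picardInv {P : Type*} [NormedAddCommGroup P] [NormedSpace ℝ P] {n : ℕ∞}
    {a : P × ℝ → R} (ha : Continuous a)
    (hS : ContDiff ℝ n fun q : P × ℝ => picardSum (fun τ => a (q.1, τ)) q.2) :
    ContDiff ℝ n fun q : P × ℝ => picardInv (fun τ => a (q.1, τ)) q.2 := by
  rw [contDiff_iff_contDiffAt]
  intro q
  obtain ⟨x, hx⟩ := isUnit_picardSum (ha.comp (by fun_prop : Continuous fun τ => (q.1, τ))) q.2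
  have h := contDiffAt_ringInverse ℝ (n := n) x
  rw [hx] at h
  exact h.comp q hS.contDiffAt

theorem hasDerivAt_picardInv {a : ℝ → R} (ha : Continuous a) (σ : ℝ) :
    HasDerivAt (picardInv a) (-(a σ * picardInv a σ)) σ := by
  obtain ⟨x, hx⟩ := isUnit_picardSum ha σ
  have h := hasFDerivAt_ringInverse (𝕜 := ℝ) x
  rw [hx] at h
  refine (h.comp_hasDerivAt σ (hasDerivAt_picardSum ha σ)).congr_deriv ?_
  simp [picardInv, ← hx]

/-- Duhamel's formula: integrate the derivative of S_b S_a⁻¹ from σ to 1. -/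
theorem picardSum_sub {a b : ℝ → R} (ha : Continuous a) (hb : Continuous b) (σ : ℝ) :
    picardSum b σ = picardSum a σ -
      (∫ τ in σ..1, picardSum b τ * (b τ - a τ) * picardInv a τ) * picardSum a σ := by
  have hai : Continuous (picardInv a) :=
    continuous_iff_continuousAt.mpr fun τ => (hasDerivAt_picardInv ha τ).continuousAt
  have hd : ∀ τ ∈ uIcc σ 1, HasDerivAt (fun τ => picardSum b τ * picardInv a τ)
      (picardSum b τ * (b τ - a τ) * picardInv a τ) τ := fun τ _ => by
    refine ((hasDerivAt_picardSum hb τ).mul (hasDerivAt_picardInv ha τ)).congr_deriv ?_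
    noncomm_ring
  rw [intervalIntegral.integral_eq_sub_of_hasDerivAt hd
    ((((continuous_picardSum hb).mul (hb.sub ha)).mul hai).intervalIntegrable _ _),
    picardSum_one hb, picardInv_one ha, sub_mul, mul_assoc (picardSum b σ),
    picardInv_mul_picardSum ha]
  simp

variable {P : Type*} [NormedAddCommGroup P] [NormedSpace ℝ P] [FiniteDimensional ℝ P]

/-- Apply Duhamel's formula to the coefficients at w and at u. The integrand carries the factor a_w
- a_u, which vanishes at w = u, so joint continuity of the series is enough to differentiate it
there. -/
theorem hasFDerivAt_picardSum {a : P × ℝ → R} (ha : ContDiff ℝ 1 a) (σ : ℝ) (u : P) :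
    HasFDerivAt (fun w => picardSum (fun τ => a (w, τ)) σ)
      (-((ContinuousLinearMap.mul ℝ R).flip (picardSum (fun τ => a (u, τ)) σ)).comp
        (∫ τ in σ..1, (ContinuousLinearMap.mulLeftRight ℝ R (picardSum (fun τ => a (u, τ)) τ)
          (picardInv (fun τ => a (u, τ)) τ)).comp ((fderiv ℝ a (u, τ)).comp (.inl ℝ P ℝ)))) u := by
  have : ProperSpace P := FiniteDimensional.proper ℝ P
  have hau : ∀ w, Continuous fun τ => a (w, τ) := fun w => ha.continuous.comp (by fun_prop)
  have hS := continuous_picardSum_uncurry ha.continuous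
  have hI : Continuous fun q : P × ℝ => picardInv (fun τ => a (q.1, τ)) q.2 :=
    (contDiff_picardInv (n := 0) ha.continuous (contDiff_zero.mpr hS)).continuous
  have hSu : ∀ w, Continuous (picardSum fun τ => a (w, τ)) := fun w => continuous_picardSum (hau w)
  have hIu : Continuous (picardInv fun τ => a (u, τ)) :=
    hI.comp (by fun_prop : Continuous fun τ : ℝ => (u, τ))
  have hD : Continuous fun q : P × ℝ => (fderiv ℝ a q).comp (.inl ℝ P ℝ) :=
    (ha.continuous_fderiv one_ne_zero).clm_comp continuous_const
  have hcpt := (isCompact_closedBall u 1).prod (isCompact_uIcc (a := σ) (b := 1))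
  obtain ⟨C₁, hC₁⟩ := exists_norm_le_of_continuous hS hcpt
  obtain ⟨C₂, hC₂⟩ := exists_norm_le_of_continuous hI hcpt
  obtain ⟨C₃, hC₃⟩ := exists_norm_le_of_continuous hD hcpt
  set F : P → ℝ → R := fun w τ => picardSum (fun τ => a (w, τ)) τ * (a (w, τ) - a (u, τ)) *
    picardInv (fun τ => a (u, τ)) τ with hF
  have hFc : ∀ w, Continuous (F w) := fun w => ((hSu w).mul ((hau w).sub (hau u))).mul hIu
  set F' : ℝ → P →L[ℝ] R := fun τ =>
    (ContinuousLinearMap.mulLeftRight ℝ R (picardSum (fun τ => a (u, τ)) τ)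
      (picardInv (fun τ => a (u, τ)) τ)).comp ((fderiv ℝ a (u, τ)).comp (.inl ℝ P ℝ)) with hF'
  have hFc' : Continuous F' := by
    refine Continuous.clm_comp ?_ (hD.comp (by fun_prop : Continuous fun τ : ℝ => (u, τ)))
    exact ((ContinuousLinearMap.mulLeftRight ℝ R).continuous.comp (hSu u)).clm_apply hIu
  have hint : HasFDerivAt (fun w => ∫ τ in σ..1, F w τ) (∫ τ in σ..1, F' τ) u := by
    simp only [intervalIntegral.intervalIntegral_eq_integral_uIoc]
    -- The integrand is known to be differentiable only at w = u, so the domination is a Lipschitz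
    -- estimate centred at u; C₁, C₃, C₂ bound S, the derivative of a, and S⁻¹.
    refine HasFDerivAt.const_smul (hasFDerivAt_integral_of_dominated_loc_of_lip'
      (bound := fun _ => C₁ * C₃ * C₂) (Metric.closedBall_mem_nhds u one_pos)
      (fun w _ => (hFc w).aestronglyMeasurable)
      ((hFc u).integrableOn_uIoc) hFc'.aestronglyMeasurable ?_ ?_ ?_).2 _
    · refine (MeasureTheory.ae_restrict_mem measurableSet_uIoc).mono fun τ hτ w hw => ?_
      have hτ' := uIoc_subset_uIcc hτ
      have hu : u ∈ Metric.closedBall u 1 := Metric.mem_closedBall_self zero_le_one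
      have h1 : ‖a (w, τ) - a (u, τ)‖ ≤ C₃ * ‖w - u‖ :=
        (convex_closedBall u 1).norm_image_sub_le_of_norm_hasFDerivWithin_le
          (f := fun w => a (w, τ)) (fun x _ => (hasFDerivAt_comp_prodMk_left (q := (x, τ))
            (ha.differentiable one_ne_zero _)).hasFDerivWithinAt)
          (fun x hx => hC₃ (x, τ) ⟨hx, hτ'⟩) hu hw
      have hC₁0 : 0 ≤ C₁ := (norm_nonneg _).trans (hC₁ (w, τ) ⟨hw, hτ'⟩)
      have hC₃0 : 0 ≤ C₃ := (norm_nonneg _).trans (hC₃ (w, τ) ⟨hw, hτ'⟩)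
      have h0 : F u τ = 0 := by simp [hF]
      rw [h0, sub_zero]
      calc ‖F w τ‖ ≤ (C₁ * (C₃ * ‖w - u‖)) * C₂ := by
            refine (norm_mul_le _ _).trans ?_
            gcongr
            · refine (norm_mul_le _ _).trans ?_
              gcongr
              exact hC₁ (w, τ) ⟨hw, hτ'⟩
            · exact hC₂ (u, τ) ⟨hu, hτ'⟩
        _ = _ := by ring
    · exact intervalIntegrable_iff.mp intervalIntegrable_const
    · refine .of_forall fun τ => ?_
      have h1 := (hasFDerivAt_comp_prodMk_left (q := (u, τ))
        (ha.differentiable one_ne_zero _)).sub_const (a (u, τ))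
      have h2 := HasFDerivAt.mul_of_continuousAt_of_eq_zero
        (f := fun w => picardSum (fun τ => a (w, τ)) τ)
        (hS.comp (by fun_prop : Continuous fun w : P => (w, τ))).continuousAt h1 (by simp)
      exact ((ContinuousLinearMap.mul ℝ R).flip
        (picardInv (fun τ => a (u, τ)) τ)).hasFDerivAt.comp u h2
  have h := (((ContinuousLinearMap.mul ℝ R).flip
    (picardSum (fun τ => a (u, τ)) σ)).hasFDerivAt.comp u hint).const_sub
      (picardSum (fun τ => a (u, τ)) σ)
  exact h.congr_of_eventuallyEq (.of_forall fun w => picardSum_sub (hau u) (hau w) σ)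

theorem fderiv_picardSum_left_apply {a : P × ℝ → R} (ha : ContDiff ℝ 1 a) (σ : ℝ) (u v : P) :
    fderiv ℝ (fun w => picardSum (fun τ => a (w, τ)) σ) u v =
      -(∫ τ in σ..1, picardSum (fun τ => a (u, τ)) τ * fderiv ℝ a (u, τ) (v, 0) *
        picardInv (fun τ => a (u, τ)) τ) * picardSum (fun τ => a (u, τ)) σ := by
  have hau : Continuous fun τ => a (u, τ) := ha.continuous.comp (by fun_prop)
  rw [(hasFDerivAt_picardSum ha σ u).fderiv]
  simp only [neg_apply, ContinuousLinearMap.comp_apply,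
    ContinuousLinearMap.flip_apply, ContinuousLinearMap.mul_apply']
  rw [ContinuousLinearMap.intervalIntegral_apply]
  · simp
  · refine Continuous.intervalIntegrable (.clm_comp ?_ (.clm_comp ?_ continuous_const)) _ _
    · refine ((ContinuousLinearMap.mulLeftRight ℝ R).continuous.comp
        (continuous_picardSum hau)).clm_apply ?_
      exact continuous_iff_continuousAt.mpr fun τ => (hasDerivAt_picardInv hau τ).continuousAt
    · exact (ha.continuous_fderiv one_ne_zero).comp (by fun_prop)

/-- Bootstrapping: the σ-derivative is S a, and the parameter derivative is an integral in S, the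
derivative of a, and S⁻¹. If S is C^n, both partial derivatives are C^n, so S is C^(n+1). -/
theorem contDiff_picardSum_nat (n : ℕ) {a : P × ℝ → R} (ha : ContDiff ℝ ∞ a) :
    ContDiff ℝ n fun q : P × ℝ => picardSum (fun τ => a (q.1, τ)) q.2 := by
  induction n with
  | zero => simpa using continuous_picardSum_uncurry ha.continuous
  | succ n ih =>
    have ha1 : ContDiff ℝ 1 a := ha.of_le (by simp)
    have hI : ContDiff ℝ n fun q : P × ℝ => picardInv (fun τ => a (q.1, τ)) q.2 :=
      contDiff_picardInv (n := n) ha.continuous ih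
    have hau : ∀ w, Continuous fun τ => a (w, τ) := fun w => ha.continuous.comp (by fun_prop)
    set f₁ : P → ℝ → P →L[ℝ] R := fun u σ => fderiv ℝ (fun w => picardSum (fun τ => a (w, τ)) σ) u
    set f₂ : P → ℝ → ℝ →L[ℝ] R := fun u σ => .toSpanSingleton ℝ
      (picardSum (fun τ => a (u, τ)) σ * a (u, σ))
    have hf₁ : ContDiff ℝ n fun q : P × ℝ => f₁ q.1 q.2 := by
      refine contDiff_clm_apply_iff.mpr fun v => ?_
      simp only [f₁, fderiv_picardSum_left_apply ha1]
      refine ContDiff.mul (ContDiff.neg ?_) ih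
      refine contDiff_intervalIntegral_of_bounds (n := n) (F := fun r : (P × ℝ) × ℝ =>
        picardSum (fun τ => a (r.1.1, τ)) r.2 * fderiv ℝ a (r.1.1, r.2) (v, 0) *
          picardInv (fun τ => a (r.1.1, τ)) r.2) ?_ contDiff_snd contDiff_const
      have hr : ContDiff ℝ n fun r : (P × ℝ) × ℝ => (r.1.1, r.2) := by fun_prop
      have hD : ContDiff ℝ n fun q => fderiv ℝ a q (v, 0) :=
        (ha.fderiv_right (m := n) (mod_cast le_top)).clm_apply contDiff_const
      exact ((ih.comp hr).mul (hD.comp hr)).mul (hI.comp hr)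
    have hf₂ : ContDiff ℝ n fun q : P × ℝ => f₂ q.1 q.2 := by
      refine contDiff_clm_apply_iff.mpr fun c => ?_
      simpa [f₂] using (ih.mul (ha.of_le (mod_cast le_top))).const_smul c
    have hd : ∀ q : P × ℝ, HasFDerivAt (fun q : P × ℝ => picardSum (fun τ => a (q.1, τ)) q.2)
        ((f₁ q.1 q.2).coprod (f₂ q.1 q.2)) q := fun q => by
      refine (hasStrictFDerivAt_uncurry_coprod (u := q) (f := fun u => picardSum fun τ => a (u, τ))
        (f₁ := f₁) (f₂ := f₂) (.of_forall fun r => ?_) (.of_forall fun r => ?_)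
        hf₁.continuous.continuousAt hf₂.continuous.continuousAt).hasFDerivAt
      · exact (hasFDerivAt_picardSum ha1 r.2 r.1).differentiableAt.hasFDerivAt
      · exact (hasDerivAt_picardSum (hau r.1) r.2).hasFDerivAt
    push_cast
    refine contDiff_succ_iff_fderiv_apply.mpr ⟨fun q => (hd q).differentiableAt, by simp,
      fun y => ?_⟩
    simp only [(hd _).fderiv, ContinuousLinearMap.coprod_apply]
    exact (hf₁.clm_apply contDiff_const).add (hf₂.clm_apply contDiff_const)

theorem contDiff_picardSum {a : P × ℝ → R} (ha : ContDiff ℝ ∞ a) :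
    ContDiff ℝ ∞ fun q : P × ℝ => picardSum (fun τ => a (q.1, τ)) q.2 :=
  contDiff_infty.mpr fun n => contDiff_picardSum_nat n ha

end SmoothDependence

/-! ### Testing smoothness of forms on fixed vectors -/

section AlternatingMaps

theorem contDiff_alternating_apply {N W V : Type*} [NormedAddCommGroup N] [NormedSpace ℝ N]
    [NormedAddCommGroup W] [NormedSpace ℝ W] [NormedAddCommGroup V] [NormedSpace ℝ V]
    {n : WithTop ℕ∞} {k : ℕ} {η : N → W [⋀^Fin k]→L[ℝ] V} (h : ContDiff ℝ n η)
    (v : Fin k → W) : ContDiff ℝ n fun x => η x v :=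
  (ContinuousAlternatingMap.apply ℝ W V v).contDiff.comp h

variable {W V : Type*} [NormedAddCommGroup W] [NormedSpace ℝ W] [FiniteDimensional ℝ W]
  [NormedAddCommGroup V] [NormedSpace ℝ V] [FiniteDimensional ℝ V]

/-- A form is determined by its values on tuples of basis vectors. This evaluation is linear and
injective, so a left inverse Ψ recovers the form; smoothness may therefore be checked on fixed
vectors. -/
theorem exists_clm_comp_apply_eq_id (W V : Type*) [NormedAddCommGroup W] [NormedSpace ℝ W]
    [FiniteDimensional ℝ W] [NormedAddCommGroup V] [NormedSpace ℝ V] [FiniteDimensional ℝ V]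
    (k : ℕ) : ∃ (T : Type) (_ : Fintype T) (v : T → Fin k → W) (Ψ : (T → V) →L[ℝ] W [⋀^Fin k]→L[ℝ] V),
      ∀ η : W [⋀^Fin k]→L[ℝ] V, Ψ (fun i => η (v i)) = η := by
  let b := Module.finBasis ℝ W
  let v : (Fin k → Fin (Module.finrank ℝ W)) → Fin k → W := fun i j => b (i j)
  let Φ : (W [⋀^Fin k]→L[ℝ] V) →ₗ[ℝ] ((Fin k → Fin (Module.finrank ℝ W)) → V) :=
    { toFun := fun η i => η (v i), map_add' := fun _ _ => rfl, map_smul' := fun _ _ => rfl }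
  have hΦ : Function.Injective Φ := fun η η' h => by
    apply ContinuousAlternatingMap.toAlternatingMap_injective
    refine Module.Basis.ext_alternating b fun i _ => ?_
    exact congrFun h i
  obtain ⟨Ψ, hΨ⟩ := Φ.exists_leftInverse_of_injective (LinearMap.ker_eq_bot.mpr hΦ)
  exact ⟨_, inferInstance, v, LinearMap.toContinuousLinearMap Ψ,
    fun η => LinearMap.congr_fun hΨ η⟩

theorem contDiffOn_alternating_of_apply {N : Type*} [NormedAddCommGroup N] [NormedSpace ℝ N]
    {n : WithTop ℕ∞} {k : ℕ} {η : N → W [⋀^Fin k]→L[ℝ] V} {s : Set N}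
    (h : ∀ v, ContDiffOn ℝ n (fun x => η x v) s) : ContDiffOn ℝ n η s := by
  obtain ⟨T, _, v, Ψ, hΨ⟩ := exists_clm_comp_apply_eq_id W V k
  have h1 : ContDiffOn ℝ n (fun x => Ψ fun i => η x (v i)) s :=
    Ψ.contDiff.comp_contDiffOn (contDiffOn_pi.mpr fun i => h (v i))
  simpa only [hΨ] using h1

theorem contDiff_alternating_of_apply {N : Type*} [NormedAddCommGroup N] [NormedSpace ℝ N]
    {n : WithTop ℕ∞} {k : ℕ} {η : N → W [⋀^Fin k]→L[ℝ] V}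
    (h : ∀ v, ContDiff ℝ n (fun x => η x v)) : ContDiff ℝ n η :=
  contDiffOn_univ.mp (contDiffOn_alternating_of_apply fun v => (h v).contDiffOn)

variable {N : Type*} [NormedAddCommGroup N] [NormedSpace ℝ N] {k : ℕ} {n : WithTop ℕ∞}

variable {E : Type*} [NormedAddCommGroup E] [NormedSpace ℝ E]

/-- The composite is linear in η and polynomial in g: it is a multilinear map with g in each of its
k slots. -/
theorem contDiffOn_compContinuousLinearMap {η : N → E [⋀^Fin k]→L[ℝ] V} {g : N → W →L[ℝ] E}
    {s : Set N} (hη : ContDiffOn ℝ n η s) (hg : ContDiffOn ℝ n g s) :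
    ContDiffOn ℝ n (fun x => (η x).compContinuousLinearMap (g x)) s := by
  refine contDiffOn_alternating_of_apply fun v => ?_
  let T : (E [⋀^Fin k]→L[ℝ] V) →L[ℝ] ContinuousMultilinearMap ℝ (fun _ : Fin k => E) V :=
    ContinuousAlternatingMap.toContinuousMultilinearMapCLM ℝ
  have h1 : ContDiffOn ℝ n (fun x =>
      ContinuousMultilinearMap.compContinuousLinearMapContinuousMultilinear
        ℝ (fun _ : Fin k => W) (fun _ => E) V (fun _ => g x) (T (η x))) s :=
    ((ContinuousMultilinearMap.contDiff _).comp_contDiffOn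
      (contDiffOn_pi.mpr fun _ => hg)).clm_apply (T.contDiff.comp_contDiffOn hη)
  exact (ContinuousMultilinearMap.apply ℝ (fun _ : Fin k => W) V v).contDiff.comp_contDiffOn h1

end AlternatingMaps

/-! ### Pullback of forms from the manifold to a vector space -/

section Pullback

variable {E : Type*} [NormedAddCommGroup E] [NormedSpace ℝ E]
  {M : Type*} [TopologicalSpace M] [ChartedSpace E M]
  {V : Type*} [NormedAddCommGroup V] [NormedSpace ℝ V]
  {W : Type*} [NormedAddCommGroup W] [NormedSpace ℝ W]
  {N : Type*} [NormedAddCommGroup N] [NormedSpace ℝ N] {k : ℕ}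

theorem tangentMapAt_comp {f : N → M} {g : W → N} {y : W}
    (hf : MDifferentiableAt 𝓘(ℝ, N) 𝓘(ℝ, E) f (g y)) (hg : DifferentiableAt ℝ g y) :
    (tangentMapAt (f ∘ g) y : W →L[ℝ] E) = (tangentMapAt f (g y)).comp (fderiv ℝ g y) := by
  rw [tangentMapAt, mfderiv_comp y hf hg.mdifferentiableAt, mfderiv_eq_fderiv]
  rfl

theorem MForm.pullback_comp (η : MForm E M k V) {f : N → M} {g : W → N} {y : W}
    (hf : MDifferentiableAt 𝓘(ℝ, N) 𝓘(ℝ, E) f (g y)) (hg : DifferentiableAt ℝ g y) :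
    η.pullback (f ∘ g) y = (η.pullback f (g y)).compContinuousLinearMap (fderiv ℝ g y) := by
  rw [MForm.pullback, tangentMapAt_comp hf hg]
  rfl

variable [IsManifold 𝓘(ℝ, E) ∞ M]

/-- Near w₀ the map f factors as φ⁻¹ ∘ (φ ∘ f) with φ the chart at f w₀, which reduces pullbacks
from `M` to pullbacks between vector spaces. -/
theorem MForm.pullback_eventuallyEq_chart (η : MForm E M k V) {f : W → M}
    (hf : ContMDiff 𝓘(ℝ, W) 𝓘(ℝ, E) ∞ f) (w₀ : W) :
    ∃ s : Set W, IsOpen s ∧ w₀ ∈ s ∧ ContDiffOn ℝ ∞ (extChartAt 𝓘(ℝ, E) (f w₀) ∘ f) s ∧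
      MapsTo (extChartAt 𝓘(ℝ, E) (f w₀) ∘ f) s (extChartAt 𝓘(ℝ, E) (f w₀)).target ∧
      ∀ w ∈ s, η.pullback f w =
        (η.pullback (extChartAt 𝓘(ℝ, E) (f w₀)).symm
          (extChartAt 𝓘(ℝ, E) (f w₀) (f w))).compContinuousLinearMap
          (fderiv ℝ (extChartAt 𝓘(ℝ, E) (f w₀) ∘ f) w) := by
  set φ := extChartAt 𝓘(ℝ, E) (f w₀) with hφ
  have hs : IsOpen (f ⁻¹' φ.source) := (isOpen_extChartAt_source (f w₀)).preimage hf.continuous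
  have hd : ContDiffOn ℝ ∞ (φ ∘ f) (f ⁻¹' φ.source) := by
    rw [← contMDiffOn_iff_contDiffOn]
    exact (contMDiffOn_extChartAt (I := 𝓘(ℝ, E)) (x := f w₀)).comp hf.contMDiffOn
      (fun w hw => by simpa [hφ] using hw)
  have hmaps : MapsTo (φ ∘ f) (f ⁻¹' φ.source) φ.target := fun w hw => φ.map_source hw
  refine ⟨f ⁻¹' φ.source, hs, mem_extChartAt_source (f w₀), hd, hmaps, fun w hw => ?_⟩
  have hsymm : MDifferentiableAt 𝓘(ℝ, E) 𝓘(ℝ, E) φ.symm ((φ ∘ f) w) :=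
    ((contMDiffOn_extChartAt_symm (n := ∞) (I := 𝓘(ℝ, E)) (f w₀)).contMDiffAt
      ((isOpen_extChartAt_target (f w₀)).mem_nhds (hmaps hw))).mdifferentiableAt (by simp)
  have hdw : DifferentiableAt ℝ (φ ∘ f) w :=
    (hd.contDiffAt (hs.mem_nhds hw)).differentiableAt (by simp)
  have heq : f =ᶠ[𝓝 w] φ.symm ∘ (φ ∘ f) :=
    (hs.mem_nhds hw : f ⁻¹' φ.source ∈ 𝓝 w) |> Filter.mem_of_superset <|
      fun x hx => (φ.left_inv hx).symm
  have h1 : η.pullback f w = η.pullback (φ.symm ∘ (φ ∘ f)) w := by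
    have h2 : tangentMapAt f w = (tangentMapAt (φ.symm ∘ (φ ∘ f)) w : W →L[ℝ] E) :=
      heq.mfderiv_eq
    rw [MForm.pullback, h2, MForm.pullback, heq.eq_of_nhds]
  rw [h1]
  exact MForm.pullback_comp η hsymm hdw

theorem MForm.IsSmooth.contDiff_pullback [FiniteDimensional ℝ W] [FiniteDimensional ℝ V]
    {η : MForm E M k V} (hη : η.IsSmooth) {f : W → M} (hf : ContMDiff 𝓘(ℝ, W) 𝓘(ℝ, E) ∞ f) :
    ContDiff ℝ ∞ (η.pullback f) := by
  rw [contDiff_iff_contDiffAt]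
  intro w₀
  obtain ⟨s, hs, hw₀, hd, hmaps, heq⟩ := η.pullback_eventuallyEq_chart hf w₀
  refine (ContDiffOn.congr ?_ heq).contDiffAt (hs.mem_nhds hw₀)
  exact contDiffOn_compContinuousLinearMap ((hη (f w₀)).comp hd hmaps)
    (hd.fderiv_of_isOpen hs (by simp))

/-- At the point w, the chart at f w is also the one in which `MForm.d` is defined there. Naturality
of the exterior derivative on vector spaces thus suffices, without comparing charts. -/
theorem MForm.IsSmooth.d_pullback {η : MForm E M k V} (hη : η.IsSmooth) {f : W → M}
    (hf : ContMDiff 𝓘(ℝ, W) 𝓘(ℝ, E) ∞ f) (w : W) :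
    η.d.pullback f w = extDeriv (η.pullback f) w := by
  obtain ⟨s, hs, hw, hd, hmaps, heq⟩ := η.pullback_eventuallyEq_chart hf w
  have h1 : η.pullback f =ᶠ[𝓝 w] _ := Filter.mem_of_superset (hs.mem_nhds hw) heq
  have hdiff : DifferentiableAt ℝ (η.pullback (extChartAt 𝓘(ℝ, E) (f w)).symm)
      ((extChartAt 𝓘(ℝ, E) (f w) ∘ f) w) :=
    ((hη (f w)).contDiffAt ((isOpen_extChartAt_target (f w)).mem_nhds (hmaps hw))).differentiableAt
      (by simp)
  have h2 := extDeriv_pullback (r := ∞) hdiff (hd.contDiffAt (hs.mem_nhds hw))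
    (by simpa using (WithTop.coe_le_coe.mpr (le_top : (2 : ℕ∞) ≤ ⊤)))
  rw [h1.extDeriv_eq]
  refine Eq.trans ?_ h2.symm
  have hφ : MDifferentiableAt 𝓘(ℝ, E) 𝓘(ℝ, E) (extChartAt 𝓘(ℝ, E) (f w)) (f w) :=
    mdifferentiableAt_extChartAt (mem_chart_source E (f w))
  let D : E →L[ℝ] E := mfderiv 𝓘(ℝ, E) 𝓘(ℝ, E) (extChartAt 𝓘(ℝ, E) (f w)) (f w)
  have h3 : fderiv ℝ (extChartAt 𝓘(ℝ, E) (f w) ∘ f) w = D.comp (tangentMapAt f w) := by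
    rw [← mfderiv_eq_fderiv, mfderiv_comp w hφ (hf.mdifferentiableAt (by simp))]
    rfl
  rw [h3]
  rfl

end Pullback

theorem hasDerivAt_prodMk_right_of_contDiff {P V : Type*} [NormedAddCommGroup P] [NormedSpace ℝ P]
    [NormedAddCommGroup V] [NormedSpace ℝ V]
    {f : P × ℝ → V} (hf : ContDiff ℝ ∞ f) (u : P) (τ : ℝ) :
    HasDerivAt (fun τ => f (u, τ)) (fderiv ℝ f (u, τ) (0, 1)) τ :=
  ((hf.differentiable (by simp)) (u, τ)).hasFDerivAt.comp_hasDerivAt τ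
    ((hasDerivAt_const τ u).prodMk (hasDerivAt_id τ))

/-! ### Products of integrals and integrals over a triangle -/

section IntegrationByParts

variable {V V₁ V₂ : Type*} [NormedAddCommGroup V] [NormedSpace ℝ V] [CompleteSpace V]
  [NormedAddCommGroup V₁] [NormedSpace ℝ V₁] [CompleteSpace V₁]
  [NormedAddCommGroup V₂] [NormedSpace ℝ V₂] [CompleteSpace V₂]

theorem hasDerivAt_integral_of_continuous {f : ℝ → V} (hf : Continuous f) (a σ : ℝ) :
    HasDerivAt (fun σ => ∫ τ in a..σ, f τ) (f σ) σ :=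
  intervalIntegral.integral_hasDerivAt_right (hf.intervalIntegrable a σ)
    (hf.stronglyMeasurableAtFilter _ _) hf.continuousAt

theorem continuous_integral_of_continuous {f : ℝ → V} (hf : Continuous f) (a : ℝ) :
    Continuous fun σ => ∫ τ in a..σ, f τ :=
  continuous_iff_continuousAt.mpr fun σ => (hasDerivAt_integral_of_continuous hf a σ).continuousAt

/-- The derivative of the product of the two primitives is the integrand on the right: the square is
cut along its diagonal. -/
theorem bilinear_integral_integral (m : V₁ →L[ℝ] V₂ →L[ℝ] V) {f : ℝ → V₁} {g : ℝ → V₂}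
    (hf : Continuous f) (hg : Continuous g) (b : ℝ) :
    m (∫ τ in (0 : ℝ)..b, f τ) (∫ τ in (0 : ℝ)..b, g τ) =
      ∫ σ in (0 : ℝ)..b, (m (f σ) (∫ τ in (0 : ℝ)..σ, g τ) + m (∫ τ in (0 : ℝ)..σ, f τ) (g σ)) := by
  have hF := continuous_integral_of_continuous hf 0
  have hG := continuous_integral_of_continuous hg 0
  have hd : ∀ σ ∈ uIcc 0 b, HasDerivAt
      (fun σ => m (∫ τ in (0 : ℝ)..σ, f τ) (∫ τ in (0 : ℝ)..σ, g τ))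
      (m (f σ) (∫ τ in (0 : ℝ)..σ, g τ) + m (∫ τ in (0 : ℝ)..σ, f τ) (g σ)) σ := fun σ _ =>
    (m.hasFDerivAt.comp_hasDerivAt σ (hasDerivAt_integral_of_continuous hf 0 σ)).clm_apply
      (hasDerivAt_integral_of_continuous hg 0 σ)
  rw [intervalIntegral.integral_eq_sub_of_hasDerivAt hd]
  · simp
  · refine Continuous.intervalIntegrable (.add ?_ ?_) _ _
    · exact (m.continuous.comp hf).clm_apply hG
    · exact (m.continuous.comp hF).clm_apply hg

/-- Fubini on the triangle σ < τ, obtained here from the product formula by subtracting one triangle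
from the square. -/
theorem integral_integral_swap_triangle {g : ℝ → V₁ →L[ℝ] V} {f : ℝ → V₁}
    (hg : Continuous g) (hf : Continuous f) :
    ∫ σ in (0 : ℝ)..1, (∫ τ in σ..1, g τ) (f σ) =
      ∫ σ in (0 : ℝ)..1, g σ (∫ τ in (0 : ℝ)..σ, f τ) := by
  have h := bilinear_integral_integral (ContinuousLinearMap.id ℝ (V₁ →L[ℝ] V)) hg hf 1
  have hF := continuous_integral_of_continuous hf 0
  have hG := continuous_integral_of_continuous hg 0
  simp only [ContinuousLinearMap.id_apply] at h
  rw [intervalIntegral.integral_add ((hg.clm_apply hF).intervalIntegrable _ _)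
    ((hG.clm_apply hf).intervalIntegrable _ _)] at h
  rw [← sub_eq_of_eq_add h, ← ContinuousLinearMap.intervalIntegral_comp_comm _
    (hf.intervalIntegrable _ _), ← intervalIntegral.integral_sub
      ((continuous_const.clm_apply hf).intervalIntegrable _ _)
      ((hG.clm_apply hf).intervalIntegrable _ _)]
  refine intervalIntegral.integral_congr fun σ _ => ?_
  rw [← sub_apply, intervalIntegral.integral_interval_sub_left (hg.intervalIntegrable _ _)
    (hg.intervalIntegrable _ _)]

end IntegrationByParts

/-! ### Transport in a differential crossed module -/

section CrossedModule

variable {𝔤 𝔥 : Type*} [NormedLieRing 𝔤] [NormedLieAlg 𝔤] [FiniteDimensional ℝ 𝔤]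
  [NormedLieRing 𝔥] [NormedLieAlg 𝔥] [FiniteDimensional ℝ 𝔥]

instance (L : Type*) [NormedLieRing L] [NormedLieAlg L] [FiniteDimensional ℝ L] :
    CompleteSpace L :=
  FiniteDimensional.complete ℝ L

theorem bracketL_apply (x y : 𝔤) : bracketL 𝔤 x y = ⁅x, y⁆ := rfl

namespace DifferentialCrossedModule

variable (𝒞 : DifferentialCrossedModule 𝔤 𝔥)

theorem actL_bracketL (x y : 𝔤) : 𝒞.actL (bracketL 𝔤 x y) =
    𝒞.actL x * 𝒞.actL y - 𝒞.actL y * 𝒞.actL x := by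
  ext z
  change 𝒞.dα ⁅x, y⁆ z = 𝒞.dα x (𝒞.dα y z) - 𝒞.dα y (𝒞.dα x z)
  simp

theorem dtL_actL (x : 𝔤) (y : 𝔥) : 𝒞.dtL (𝒞.actL x y) = bracketL 𝔤 x (𝒞.dtL y) := 𝒞.dt_dα x y

theorem actL_dtL (y z : 𝔥) : 𝒞.actL (𝒞.dtL y) z = bracketL 𝔥 y z := 𝒞.dα_dt y z

variable {x : ℝ → 𝔤}

/-- With z = G(σ) y frozen, τ ↦ W dα(G⁻¹ z) W⁻¹ is constant, since dα turns brackets into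
commutators. Its values at σ and at 1 are the two sides. -/
theorem picardSum_actL_conj (hx : Continuous x) (σ : ℝ) (y : 𝔤) :
    picardSum (fun τ => 𝒞.actL (x τ)) σ * 𝒞.actL y * picardInv (fun τ => 𝒞.actL (x τ)) σ =
      𝒞.actL (picardSum (fun τ => bracketL 𝔤 (x τ)) σ y) := by
  have ha : Continuous fun τ => 𝒞.actL (x τ) := 𝒞.actL.continuous.comp hx
  have hb : Continuous fun τ => bracketL 𝔤 (x τ) := (bracketL 𝔤).continuous.comp hx
  set z := picardSum (fun τ => bracketL 𝔤 (x τ)) σ y with hz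
  set f : ℝ → 𝔥 →L[ℝ] 𝔥 := fun τ => picardSum (fun τ => 𝒞.actL (x τ)) τ *
    𝒞.actL (picardInv (fun τ => bracketL 𝔤 (x τ)) τ z) * picardInv (fun τ => 𝒞.actL (x τ)) τ with hf
  have hd : ∀ τ, HasDerivAt f 0 τ := fun τ => by
    have h1 := ((hasDerivAt_picardInv hb τ).clm_apply (hasDerivAt_const τ z))
    refine (((hasDerivAt_picardSum ha τ).mul (𝒞.actL.hasFDerivAt.comp_hasDerivAt τ h1)).mul
      (hasDerivAt_picardInv ha τ)).congr_deriv ?_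
    simp only [neg_apply, mul_apply_eq_comp, map_neg, map_zero, add_zero,
      actL_bracketL, Pi.mul_apply, Function.comp_apply]
    noncomm_ring
  have h1 : f σ = f 1 :=
    is_const_of_deriv_eq_zero (fun τ => (hd τ).differentiableAt) (fun τ => (hd τ).deriv) σ 1
  have h2 : picardInv (fun τ => bracketL 𝔤 (x τ)) σ z = y := by
    rw [hz, ← mul_apply_eq_comp, picardInv_mul_picardSum hb]
    rfl
  simp only [hf, h2, picardSum_one ha, picardInv_one ha, picardInv_one hb] at h1
  simpa using h1

/-- The same argument for τ ↦ G dt(W⁻¹ y) with y frozen, now using the equivariance of dt. -/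
theorem dtL_picardSum (hx : Continuous x) (σ : ℝ) (z : 𝔥) :
    𝒞.dtL (picardSum (fun τ => 𝒞.actL (x τ)) σ z) =
      picardSum (fun τ => bracketL 𝔤 (x τ)) σ (𝒞.dtL z) := by
  have ha : Continuous fun τ => 𝒞.actL (x τ) := 𝒞.actL.continuous.comp hx
  have hb : Continuous fun τ => bracketL 𝔤 (x τ) := (bracketL 𝔤).continuous.comp hx
  set y := picardSum (fun τ => 𝒞.actL (x τ)) σ z with hy
  set f : ℝ → 𝔤 := fun τ => picardSum (fun τ => bracketL 𝔤 (x τ)) τ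
    (𝒞.dtL (picardInv (fun τ => 𝒞.actL (x τ)) τ y)) with hf
  have hd : ∀ τ, HasDerivAt f 0 τ := fun τ => by
    have h1 := 𝒞.dtL.hasFDerivAt.comp_hasDerivAt τ
      ((hasDerivAt_picardInv ha τ).clm_apply (hasDerivAt_const τ y))
    refine ((hasDerivAt_picardSum hb τ).clm_apply h1).congr_deriv ?_
    simp [dtL_actL]
  have h1 : f σ = f 1 :=
    is_const_of_deriv_eq_zero (fun τ => (hd τ).differentiableAt) (fun τ => (hd τ).deriv) σ 1
  have h2 : picardInv (fun τ => 𝒞.actL (x τ)) σ y = z := by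
    rw [hy, ← mul_apply_eq_comp, picardInv_mul_picardSum ha]
    rfl
  simp only [hf, h2, picardSum_one hb, picardInv_one ha] at h1
  simpa using h1.symm

end DifferentialCrossedModule

variable {P : Type*} [NormedAddCommGroup P] [NormedSpace ℝ P] [FiniteDimensional ℝ P]

/-- The derivative of parallel transport with respect to the path. -/
theorem DifferentialCrossedModule.fderiv_picardSum_actL (𝒞 : DifferentialCrossedModule 𝔤 𝔥)
    {aK aV : P × ℝ → 𝔤} (hK : ContDiff ℝ ∞ aK) (hV : ContDiff ℝ ∞ aV) (u v : P)
    (hV1 : aV (u, 1) = 0) (σ : ℝ) :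
    fderiv ℝ (fun w => picardSum (fun τ => 𝒞.actL (aK (w, τ))) σ) u v =
      picardSum (fun τ => 𝒞.actL (aK (u, τ))) σ * 𝒞.actL (aV (u, σ)) +
      (∫ τ in σ..1, 𝒞.actL (picardSum (fun τ => bracketL 𝔤 (aK (u, τ))) τ
        (fderiv ℝ aV (u, τ) (0, 1) - fderiv ℝ aK (u, τ) (v, 0) +
          bracketL 𝔤 (aK (u, τ)) (aV (u, τ))))) *
      picardSum (fun τ => 𝒞.actL (aK (u, τ))) σ := by
  have hx : Continuous fun τ => aK (u, τ) := hK.continuous.comp (by fun_prop)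
  have hy : Continuous fun τ => aV (u, τ) := hV.continuous.comp (by fun_prop)
  have ha : Continuous fun τ => 𝒞.actL (aK (u, τ)) := 𝒞.actL.continuous.comp hx
  have hb : Continuous fun τ => bracketL 𝔤 (aK (u, τ)) := (bracketL 𝔤).continuous.comp hx
  have haK : ContDiff ℝ ∞ fun q => 𝒞.actL (aK q) := 𝒞.actL.contDiff.comp hK
  set W := picardSum fun τ => 𝒞.actL (aK (u, τ)) with hW
  set W' := picardInv fun τ => 𝒞.actL (aK (u, τ)) with hW'
  set G := picardSum fun τ => bracketL 𝔤 (aK (u, τ)) with hG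
  have hWc : Continuous W := continuous_picardSum ha
  have hGc : Continuous G := continuous_picardSum hb
  have hW'c : Continuous W' :=
    continuous_iff_continuousAt.mpr fun τ => (hasDerivAt_picardInv ha τ).continuousAt
  have hDK : Continuous fun τ : ℝ => fderiv ℝ aK (u, τ) (v, 0) :=
    ((hK.continuous_fderiv (by simp)).comp (by fun_prop : Continuous fun τ : ℝ => (u, τ))).clm_apply
      continuous_const
  have hDV : Continuous fun τ : ℝ => fderiv ℝ aV (u, τ) (0, 1) :=
    ((hV.continuous_fderiv (by simp)).comp (by fun_prop : Continuous fun τ : ℝ => (u, τ))).clm_apply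
      continuous_const
  rw [fderiv_picardSum_left_apply (haK.of_le (by simp))]
  have hfd : ∀ τ, fderiv ℝ (fun q => 𝒞.actL (aK q)) (u, τ) (v, 0) =
      𝒞.actL (fderiv ℝ aK (u, τ) (v, 0)) := fun τ => by
    have := (𝒞.actL.hasFDerivAt.comp (u, τ)
      (hK.differentiable (by simp) (u, τ)).hasFDerivAt).fderiv
    exact congrArg (fun L => L (v, 0)) this
  simp only [hfd]
  -- Integration by parts: the derivative of W dα(A(v)) W⁻¹ is the transported curvature F_A(K, v)
  -- plus the Duhamel integrand W dα(∂_v A(K)) W⁻¹. The boundary term at 1 vanishes because A(v)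
  -- does.
  have hd : ∀ τ ∈ uIcc σ 1, HasDerivAt (fun τ => W τ * 𝒞.actL (aV (u, τ)) * W' τ)
      (𝒞.actL (G τ (fderiv ℝ aV (u, τ) (0, 1) - fderiv ℝ aK (u, τ) (v, 0) +
          bracketL 𝔤 (aK (u, τ)) (aV (u, τ)))) +
        W τ * 𝒞.actL (fderiv ℝ aK (u, τ) (v, 0)) * W' τ) τ := fun τ _ => by
    refine (((hasDerivAt_picardSum ha τ).mul (𝒞.actL.hasFDerivAt.comp_hasDerivAt τ
      (hasDerivAt_prodMk_right_of_contDiff hV u τ))).mul (hasDerivAt_picardInv ha τ)).congr_deriv ?_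
    rw [hG, ← 𝒞.picardSum_actL_conj hx, map_add, map_sub, 𝒞.actL_bracketL]
    simp only [hW, hW', Function.comp_apply]
    noncomm_ring
  have hi₁ : Continuous fun τ => 𝒞.actL (G τ (fderiv ℝ aV (u, τ) (0, 1) -
      fderiv ℝ aK (u, τ) (v, 0) + bracketL 𝔤 (aK (u, τ)) (aV (u, τ)))) :=
    𝒞.actL.continuous.comp (hGc.clm_apply ((hDV.sub hDK).add (hb.clm_apply hy)))
  have hi₂ : Continuous fun τ => W τ * 𝒞.actL (fderiv ℝ aK (u, τ) (v, 0)) * W' τ :=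
    (hWc.mul (𝒞.actL.continuous.comp hDK)).mul hW'c
  have h := intervalIntegral.integral_eq_sub_of_hasDerivAt hd
    ((hi₁.add hi₂).intervalIntegrable _ _)
  rw [intervalIntegral.integral_add (hi₁.intervalIntegrable _ _) (hi₂.intervalIntegrable _ _)] at h
  rw [eq_sub_of_add_eq h, hV1]
  simp only [map_zero, mul_zero, zero_mul, zero_sub, sub_mul, neg_mul]
  rw [mul_assoc (W σ * _) (W' σ), picardInv_mul_picardSum ha, mul_one]
  abel

end CrossedModule

theorem continuous_line {P V : Type*} [NormedAddCommGroup P] [NormedSpace ℝ P]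
    [NormedAddCommGroup V] [NormedSpace ℝ V] {f : P × ℝ → V} (x : P) (hf : ContDiff ℝ ∞ f) :
    Continuous fun σ : ℝ => f (x, σ) :=
  hf.continuous.comp (by fun_prop)

theorem continuous_fderiv_line {P V : Type*} [NormedAddCommGroup P] [NormedSpace ℝ P]
    [NormedAddCommGroup V] [NormedSpace ℝ V] {f : P × ℝ → V} (x : P) (y : P × ℝ)
    (hf : ContDiff ℝ ∞ f) : Continuous fun σ : ℝ => fderiv ℝ f (x, σ) y :=
  ((hf.continuous_fderiv (by simp)).comp (by fun_prop : Continuous fun σ : ℝ => (x, σ))).clm_apply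
    continuous_const

/-! ### The curvature identity for functions on P × ℝ -/

section CurvatureIdentity

variable {𝔤 𝔥 : Type*} [NormedLieRing 𝔤] [NormedLieAlg 𝔤] [FiniteDimensional ℝ 𝔤]
  [NormedLieRing 𝔥] [NormedLieAlg 𝔥] [FiniteDimensional ℝ 𝔥]
  {P : Type*} [NormedAddCommGroup P] [NormedSpace ℝ P] [FiniteDimensional ℝ P]

namespace DifferentialCrossedModule

variable (𝒞 : DifferentialCrossedModule 𝔤 𝔥)

/-- Product rule under the integral. The local part of the variation of W joins ∂_v b to a covariant
derivative; the curvature integral remains. -/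
theorem fderiv_integral_picardSum_apply {aK aV : P × ℝ → 𝔤} {b : P × ℝ → 𝔥}
    (hK : ContDiff ℝ ∞ aK) (hV : ContDiff ℝ ∞ aV) (hb : ContDiff ℝ ∞ b) (u v : P)
    (hV1 : aV (u, 1) = 0) :
    fderiv ℝ (fun w => ∫ σ in (0 : ℝ)..1, picardSum (fun τ => 𝒞.actL (aK (w, τ))) σ (b (w, σ))) u v =
      ∫ σ in (0 : ℝ)..1, (picardSum (fun τ => 𝒞.actL (aK (u, τ))) σ
          (fderiv ℝ b (u, σ) (v, 0) + 𝒞.actL (aV (u, σ)) (b (u, σ))) +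
        (∫ τ in σ..1, 𝒞.actL (picardSum (fun τ => bracketL 𝔤 (aK (u, τ))) τ
          (fderiv ℝ aV (u, τ) (0, 1) - fderiv ℝ aK (u, τ) (v, 0) +
            bracketL 𝔤 (aK (u, τ)) (aV (u, τ)))))
          (picardSum (fun τ => 𝒞.actL (aK (u, τ))) σ (b (u, σ)))) := by
  have haK : ContDiff ℝ ∞ fun q => 𝒞.actL (aK q) := 𝒞.actL.contDiff.comp hK
  have hW := contDiff_picardSum haK
  rw [fderiv_intervalIntegral_apply
    (F := fun q : P × ℝ => picardSum (fun τ => 𝒞.actL (aK (q.1, τ))) q.2 (b q))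
    ((hW.clm_apply hb).of_le (by simp))]
  refine intervalIntegral.integral_congr fun σ _ => ?_
  have hWd := hW.differentiable (by simp) (u, σ)
  have hbd := hb.differentiable (by simp) (u, σ)
  have h1 : fderiv ℝ (fun q : P × ℝ => picardSum (fun τ => 𝒞.actL (aK (q.1, τ))) q.2) (u, σ) (v, 0) =
      fderiv ℝ (fun w => picardSum (fun τ => 𝒞.actL (aK (w, τ))) σ) u v := by
    rw [(hasFDerivAt_comp_prodMk_left hWd).fderiv]
    simp
  rw [fderiv_clm_apply hWd hbd]
  simp only [add_apply, ContinuousLinearMap.comp_apply, ContinuousLinearMap.flip_apply]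
  rw [h1, 𝒞.fderiv_picardSum_actL hK hV u v hV1]
  simp only [add_apply, mul_apply_eq_comp, map_add]
  abel

/-- The letters K, V, U stand for the directions (0, 1), (v, 0), (w, 0): `aK`, `aV`, `aU` are
components of A, and `bV` = B(K, V), `bU` = B(K, U), `bVU` = B(V, U). Then `H` is (d_A B)(K, V, U),
and `ΦV`, `ΦU` are the fake curvature on (K, V) and (K, U). -/
theorem curvature_identity {aK aV aU : P × ℝ → 𝔤} {bV bU bVU : P × ℝ → 𝔥}
    (hK : ContDiff ℝ ∞ aK) (hV : ContDiff ℝ ∞ aV) (hU : ContDiff ℝ ∞ aU)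
    (hbV : ContDiff ℝ ∞ bV) (hbU : ContDiff ℝ ∞ bU) (hbVU : ContDiff ℝ ∞ bVU) (x v w : P)
    (hV1 : aV (x, 1) = 0) (hU1 : aU (x, 1) = 0) (h0 : bVU (x, 0) = 0) (h1 : bVU (x, 1) = 0)
    {H : ℝ → 𝔥} (hH : ∀ σ, H σ = fderiv ℝ bVU (x, σ) (0, 1) - fderiv ℝ bU (x, σ) (v, 0) +
      fderiv ℝ bV (x, σ) (w, 0) + (𝒞.actL (aK (x, σ)) (bVU (x, σ)) -
      𝒞.actL (aV (x, σ)) (bU (x, σ)) + 𝒞.actL (aU (x, σ)) (bV (x, σ))))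
    {ΦV ΦU : ℝ → 𝔤}
    (hΦV : ∀ σ, ΦV σ = fderiv ℝ aV (x, σ) (0, 1) - fderiv ℝ aK (x, σ) (v, 0) +
      bracketL 𝔤 (aK (x, σ)) (aV (x, σ)) + 𝒞.dtL (bV (x, σ)))
    (hΦU : ∀ σ, ΦU σ = fderiv ℝ aU (x, σ) (0, 1) - fderiv ℝ aK (x, σ) (w, 0) +
      bracketL 𝔤 (aK (x, σ)) (aU (x, σ)) + 𝒞.dtL (bU (x, σ)))
    {W : P → ℝ → 𝔥 →L[ℝ] 𝔥} (hW : W = fun u => picardSum fun τ => 𝒞.actL (aK (u, τ)))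
    {G : ℝ → 𝔤 →L[ℝ] 𝔤} (hG : G = picardSum fun τ => bracketL 𝔤 (aK (x, τ))) :
    fderiv ℝ (fun u => ∫ σ in (0 : ℝ)..1, W u σ (bU (u, σ))) x v -
        fderiv ℝ (fun u => ∫ σ in (0 : ℝ)..1, W u σ (bV (u, σ))) x w +
        bracketL 𝔥 (∫ σ in (0 : ℝ)..1, W x σ (bV (x, σ))) (∫ σ in (0 : ℝ)..1, W x σ (bU (x, σ))) =
      -(∫ σ in (0 : ℝ)..1, W x σ (H σ)) -
        ∫ σ in (0 : ℝ)..1, ∫ τ in (0 : ℝ)..σ,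
          (𝒞.actL (G σ (ΦU σ)) (W x τ (bV (x, τ))) - 𝒞.actL (G σ (ΦV σ)) (W x τ (bU (x, τ)))) := by
  have hx : Continuous fun τ => aK (x, τ) := continuous_line x hK
  have ha : Continuous fun τ => 𝒞.actL (aK (x, τ)) := 𝒞.actL.continuous.comp hx
  have hWc : Continuous (W x) := by rw [hW]; exact continuous_picardSum ha
  have hGc : Continuous G := by
    rw [hG]; exact continuous_picardSum ((bracketL 𝔤).continuous.comp hx)
  set FV : ℝ → 𝔤 := fun τ => fderiv ℝ aV (x, τ) (0, 1) - fderiv ℝ aK (x, τ) (v, 0) +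
    bracketL 𝔤 (aK (x, τ)) (aV (x, τ)) with hFV
  set FU : ℝ → 𝔤 := fun τ => fderiv ℝ aU (x, τ) (0, 1) - fderiv ℝ aK (x, τ) (w, 0) +
    bracketL 𝔤 (aK (x, τ)) (aU (x, τ)) with hFU
  have hFVc : Continuous FV := ((continuous_fderiv_line x _ hV).sub (continuous_fderiv_line x _ hK)).add
    (((bracketL 𝔤).continuous.comp hx).clm_apply (continuous_line x hV))
  have hFUc : Continuous FU := ((continuous_fderiv_line x _ hU).sub (continuous_fderiv_line x _ hK)).add
    (((bracketL 𝔤).continuous.comp hx).clm_apply (continuous_line x hU))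
  set gV : ℝ → 𝔥 →L[ℝ] 𝔥 := fun τ => 𝒞.actL (G τ (FV τ)) with hgV
  set gU : ℝ → 𝔥 →L[ℝ] 𝔥 := fun τ => 𝒞.actL (G τ (FU τ)) with hgU
  have hgVc : Continuous gV := 𝒞.actL.continuous.comp (hGc.clm_apply hFVc)
  have hgUc : Continuous gU := 𝒞.actL.continuous.comp (hGc.clm_apply hFUc)
  set βV : ℝ → 𝔥 := fun σ => W x σ (bV (x, σ)) with hβV
  set βU : ℝ → 𝔥 := fun σ => W x σ (bU (x, σ)) with hβU
  have hβVc : Continuous βV := hWc.clm_apply (continuous_line x hbV)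
  have hβUc : Continuous βU := hWc.clm_apply (continuous_line x hbU)
  have hIV := continuous_integral_of_continuous hβVc 0
  have hIU := continuous_integral_of_continuous hβUc 0
  have hJV : Continuous fun σ => ∫ τ in σ..1, gV τ := by
    simp only [intervalIntegral.integral_symm (1 : ℝ)]
    exact (continuous_integral_of_continuous hgVc 1).neg
  have hJU : Continuous fun σ => ∫ τ in σ..1, gU τ := by
    simp only [intervalIntegral.integral_symm (1 : ℝ)]
    exact (continuous_integral_of_continuous hgUc 1).neg
  have hHc : Continuous H := by
    rw [funext hH]
    exact (((continuous_fderiv_line x _ hbVU).sub (continuous_fderiv_line x _ hbU)).add (continuous_fderiv_line x _ hbV)).add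
      (((ha.clm_apply (continuous_line x hbVU)).sub
        ((𝒞.actL.continuous.comp (continuous_line x hV)).clm_apply (continuous_line x hbU))).add
        ((𝒞.actL.continuous.comp (continuous_line x hU)).clm_apply (continuous_line x hbV)))
  have hdV : fderiv ℝ (fun u => ∫ σ in (0 : ℝ)..1, W u σ (bU (u, σ))) x v =
      ∫ σ in (0 : ℝ)..1, (W x σ (fderiv ℝ bU (x, σ) (v, 0) + 𝒞.actL (aV (x, σ)) (bU (x, σ))) +
        (∫ τ in σ..1, gV τ) (βU σ)) := by
    subst hW hG
    exact 𝒞.fderiv_integral_picardSum_apply hK hV hbU x v hV1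
  have hdU : fderiv ℝ (fun u => ∫ σ in (0 : ℝ)..1, W u σ (bV (u, σ))) x w =
      ∫ σ in (0 : ℝ)..1, (W x σ (fderiv ℝ bV (x, σ) (w, 0) + 𝒞.actL (aU (x, σ)) (bV (x, σ))) +
        (∫ τ in σ..1, gU τ) (βV σ)) := by
    subst hW hG
    exact 𝒞.fderiv_integral_picardSum_apply hK hU hbV x w hU1
  have hcont : ∀ {b : P × ℝ → 𝔥} {a : P × ℝ → 𝔤} {c : P × ℝ → 𝔥} (y : P × ℝ), ContDiff ℝ ∞ b →
      ContDiff ℝ ∞ a → ContDiff ℝ ∞ c →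
      Continuous fun σ => W x σ (fderiv ℝ b (x, σ) y + 𝒞.actL (a (x, σ)) (c (x, σ))) :=
    fun y hb ha hc => hWc.clm_apply ((continuous_fderiv_line x y hb).add
      ((𝒞.actL.continuous.comp (continuous_line x ha)).clm_apply (continuous_line x hc)))
  -- The integrand is the σ-derivative of W B(V, U), which vanishes at both ends.
  have hbdry : ∫ σ in (0 : ℝ)..1, W x σ (fderiv ℝ bVU (x, σ) (0, 1) +
      𝒞.actL (aK (x, σ)) (bVU (x, σ))) = 0 := by
    have hd : ∀ σ ∈ uIcc (0 : ℝ) 1, HasDerivAt (fun σ => W x σ (bVU (x, σ)))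
        (W x σ (fderiv ℝ bVU (x, σ) (0, 1) + 𝒞.actL (aK (x, σ)) (bVU (x, σ)))) σ := fun σ _ => by
      have hWd : HasDerivAt (W x) (W x σ * 𝒞.actL (aK (x, σ))) σ := by
        rw [hW]; exact hasDerivAt_picardSum ha σ
      refine (hWd.clm_apply (hasDerivAt_prodMk_right_of_contDiff hbVU x σ)).congr_deriv ?_
      simp [add_comm]
    rw [intervalIntegral.integral_eq_sub_of_hasDerivAt hd
      ((hcont _ hbVU hK hbVU).intervalIntegrable _ _), h0, h1]
    simp
  have hdiff : ∀ σ, W x σ (fderiv ℝ bU (x, σ) (v, 0) + 𝒞.actL (aV (x, σ)) (bU (x, σ))) -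
      W x σ (fderiv ℝ bV (x, σ) (w, 0) + 𝒞.actL (aU (x, σ)) (bV (x, σ))) =
      W x σ (fderiv ℝ bVU (x, σ) (0, 1) + 𝒞.actL (aK (x, σ)) (bVU (x, σ))) - W x σ (H σ) :=
    fun σ => by
      rw [← map_sub, ← map_sub, hH]
      congr 1
      abel
  -- The dt(B) part of the fake curvature becomes a bracket by G dt = dt W and dα(dt y) = [y, ·];
  -- these brackets are the two triangles of 𝒜 ∧ 𝒜.
  have hinner : ∀ σ, ∫ τ in (0 : ℝ)..σ, (𝒞.actL (G σ (ΦU σ)) (W x τ (bV (x, τ))) -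
        𝒞.actL (G σ (ΦV σ)) (W x τ (bU (x, τ)))) =
      (gU σ (∫ τ in (0 : ℝ)..σ, βV τ) - bracketL 𝔥 (∫ τ in (0 : ℝ)..σ, βV τ) (βU σ)) -
      (gV σ (∫ τ in (0 : ℝ)..σ, βU τ) + bracketL 𝔥 (βV σ) (∫ τ in (0 : ℝ)..σ, βU τ)) := fun σ => by
    have hdt : ∀ z, G σ (𝒞.dtL z) = 𝒞.dtL (W x σ z) := fun z => by
      rw [hW, hG]; exact (𝒞.dtL_picardSum hx σ z).symm
    rw [intervalIntegral.integral_sub ((continuous_const.clm_apply hβVc).intervalIntegrable _ _)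
      ((continuous_const.clm_apply hβUc).intervalIntegrable _ _),
      ContinuousLinearMap.intervalIntegral_comp_comm _ (hβVc.intervalIntegrable _ _),
      ContinuousLinearMap.intervalIntegral_comp_comm _ (hβUc.intervalIntegrable _ _),
      hΦU, hΦV, map_add (G σ) _ (𝒞.dtL _), map_add (G σ) _ (𝒞.dtL _), hdt, hdt,
      map_add 𝒞.actL _ (𝒞.dtL _), map_add 𝒞.actL _ (𝒞.dtL _), add_apply, add_apply,
      𝒞.actL_dtL, 𝒞.actL_dtL, bracketL_apply (W x σ _), ← lie_skew]
    simp only [hgV, hgU, hFV, hFU, hβV, hβU, bracketL_apply]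
    abel
  have hbr := bilinear_integral_integral (bracketL 𝔥) hβVc hβUc 1
  have hc₁ : Continuous fun σ => bracketL 𝔥 (βV σ) (∫ τ in (0 : ℝ)..σ, βU τ) :=
    ((bracketL 𝔥).continuous.comp hβVc).clm_apply hIU
  have hc₂ : Continuous fun σ => bracketL 𝔥 (∫ τ in (0 : ℝ)..σ, βV τ) (βU σ) :=
    ((bracketL 𝔥).continuous.comp hIV).clm_apply hβUc
  have hc₃ : Continuous fun σ => gU σ (∫ τ in (0 : ℝ)..σ, βV τ) := hgUc.clm_apply hIV
  have hc₄ : Continuous fun σ => gV σ (∫ τ in (0 : ℝ)..σ, βU τ) := hgVc.clm_apply hIU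
  have hc₅ := hcont (v, 0) hbU hV hbU
  have hc₆ := hcont (w, 0) hbV hU hbV
  have hc₇ := hcont (0, 1) hbVU hK hbVU
  have hc₈ : Continuous fun σ => W x σ (H σ) := hWc.clm_apply hHc
  have hc₃₂ : Continuous fun σ => gU σ (∫ τ in (0 : ℝ)..σ, βV τ) -
      bracketL 𝔥 (∫ τ in (0 : ℝ)..σ, βV τ) (βU σ) := hc₃.sub hc₂
  have hc₄₁ : Continuous fun σ => gV σ (∫ τ in (0 : ℝ)..σ, βU τ) +
      bracketL 𝔥 (βV σ) (∫ τ in (0 : ℝ)..σ, βU τ) := hc₄.add hc₁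
  have hmain : (∫ σ in (0 : ℝ)..1, W x σ (fderiv ℝ bU (x, σ) (v, 0) +
      𝒞.actL (aV (x, σ)) (bU (x, σ)))) - (∫ σ in (0 : ℝ)..1, W x σ (fderiv ℝ bV (x, σ) (w, 0) +
      𝒞.actL (aU (x, σ)) (bV (x, σ)))) = -∫ σ in (0 : ℝ)..1, W x σ (H σ) := by
    rw [← intervalIntegral.integral_sub (hc₅.intervalIntegrable _ _) (hc₆.intervalIntegrable _ _)]
    simp only [hdiff]
    rw [intervalIntegral.integral_sub (hc₇.intervalIntegrable _ _) (hc₈.intervalIntegrable _ _),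
      hbdry, zero_sub]
  rw [hdV, hdU, hbr]
  simp only [hinner]
  -- Swapping the triangles puts the curvature outside and the transported B inside, as in the
  -- double integral on the right.
  rw [intervalIntegral.integral_add (hc₅.intervalIntegrable _ _)
      ((hJV.clm_apply hβUc).intervalIntegrable _ _),
    intervalIntegral.integral_add (hc₆.intervalIntegrable _ _)
      ((hJU.clm_apply hβVc).intervalIntegrable _ _),
    integral_integral_swap_triangle hgVc hβUc, integral_integral_swap_triangle hgUc hβVc,
    intervalIntegral.integral_sub (hc₃₂.intervalIntegrable _ _)
      (hc₄₁.intervalIntegrable _ _),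
    intervalIntegral.integral_sub (hc₃.intervalIntegrable _ _) (hc₂.intervalIntegrable _ _),
    intervalIntegral.integral_add (hc₄.intervalIntegrable _ _) (hc₁.intervalIntegrable _ _),
    intervalIntegral.integral_add (hc₁.intervalIntegrable _ _) (hc₂.intervalIntegrable _ _),
    ← hmain]
  abel

end DifferentialCrossedModule

end CurvatureIdentity

/-! ### Wedge products and exterior derivatives in low degree -/

section FormAlgebra

theorem removeNth_three {W : Type*} (x y z : W) :
    (0 : Fin 3).removeNth ![x, y, z] = ![y, z] ∧ (1 : Fin 3).removeNth ![x, y, z] = ![x, z] ∧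
      (2 : Fin 3).removeNth ![x, y, z] = ![x, y] := by
  refine ⟨?_, ?_, ?_⟩ <;> ext i <;> fin_cases i <;> rfl

variable {W V₁ V₂ V₃ : Type*} [NormedAddCommGroup W] [NormedSpace ℝ W]
  [NormedAddCommGroup V₁] [NormedSpace ℝ V₁] [NormedAddCommGroup V₂] [NormedSpace ℝ V₂]
  [NormedAddCommGroup V₃] [NormedSpace ℝ V₃] {k : ℕ}

theorem wedgeOne_compContinuousLinearMap {W' : Type*} [NormedAddCommGroup W'] [NormedSpace ℝ W']
    (m : V₁ →L[ℝ] V₂ →L[ℝ] V₃) (a : W [⋀^Fin 1]→L[ℝ] V₁) (η : W [⋀^Fin k]→L[ℝ] V₂)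
    (L : W' →L[ℝ] W) :
    wedgeOne m (a.compContinuousLinearMap L) (η.compContinuousLinearMap L) =
      (wedgeOne m a η).compContinuousLinearMap L := by
  ext v
  simp only [wedgeOne_apply, ContinuousAlternatingMap.compContinuousLinearMap_apply]
  rfl

theorem wedgeOne_zero (m : V₁ →L[ℝ] V₂ →L[ℝ] V₃) (a : W [⋀^Fin 1]→L[ℝ] V₁) :
    wedgeOne m a (0 : W [⋀^Fin k]→L[ℝ] V₂) = 0 := by
  ext v
  simp [wedgeOne_apply]

theorem wedgeOne_apply_two (m : V₁ →L[ℝ] V₂ →L[ℝ] V₃) (a : W [⋀^Fin 1]→L[ℝ] V₁)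
    (η : W [⋀^Fin 1]→L[ℝ] V₂) (x y : W) :
    wedgeOne m a η ![x, y] =
      m (a fun _ => x) (η fun _ => y) - m (a fun _ => y) (η fun _ => x) := by
  rw [wedgeOne_apply, Fin.sum_univ_two]
  have h0 : (0 : Fin 2).removeNth ![x, y] = fun _ => y := by ext i; fin_cases i; rfl
  have h1 : (1 : Fin 2).removeNth ![x, y] = fun _ => x := by ext i; fin_cases i; rfl
  rw [h0, h1]
  simp [sub_eq_add_neg]

theorem wedgeOne_apply_three (m : V₁ →L[ℝ] V₂ →L[ℝ] V₃) (a : W [⋀^Fin 1]→L[ℝ] V₁)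
    (η : W [⋀^Fin 2]→L[ℝ] V₂) (x y z : W) :
    wedgeOne m a η ![x, y, z] =
      m (a fun _ => x) (η ![y, z]) - m (a fun _ => y) (η ![x, z]) +
        m (a fun _ => z) (η ![x, y]) := by
  obtain ⟨h0, h1, h2⟩ := removeNth_three x y z
  rw [wedgeOne_apply, Fin.sum_univ_three, h0, h1, h2]
  simp [sub_eq_add_neg]

theorem extDeriv_apply_two {η : W → W [⋀^Fin 1]→L[ℝ] V₁} {q : W} (h : DifferentiableAt ℝ η q)
    (x y : W) : extDeriv η q ![x, y] =
      fderiv ℝ (fun r => η r fun _ => y) q x - fderiv ℝ (fun r => η r fun _ => x) q y := by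
  rw [extDeriv_apply h, Fin.sum_univ_two]
  have h0 : (0 : Fin 2).removeNth ![x, y] = fun _ => y := by ext i; fin_cases i; rfl
  have h1 : (1 : Fin 2).removeNth ![x, y] = fun _ => x := by ext i; fin_cases i; rfl
  rw [h0, h1]
  simp [sub_eq_add_neg]

theorem extDeriv_apply_three {η : W → W [⋀^Fin 2]→L[ℝ] V₁} {q : W} (h : DifferentiableAt ℝ η q)
    (x y z : W) : extDeriv η q ![x, y, z] =
      fderiv ℝ (fun r => η r ![y, z]) q x - fderiv ℝ (fun r => η r ![x, z]) q y +
        fderiv ℝ (fun r => η r ![x, y]) q z := by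
  obtain ⟨h0, h1, h2⟩ := removeNth_three x y z
  rw [extDeriv_apply h, Fin.sum_univ_three, h0, h1, h2]
  simp [sub_eq_add_neg]

theorem contDiff_extDeriv {η : W → W [⋀^Fin k]→L[ℝ] V₁} (h : ContDiff ℝ ∞ η) :
    ContDiff ℝ ∞ (extDeriv η) := by
  have h1 : extDeriv η =
      fun x => ContinuousAlternatingMap.alternatizeUncurryFinCLM ℝ W V₁ (fderiv ℝ η x) := by
    funext x
    simp [extDeriv]
  rw [h1]
  exact (ContinuousLinearMap.contDiff _).comp (h.fderiv_right (m := ∞) (by simp))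

theorem contDiff_wedgeOne [FiniteDimensional ℝ W] [FiniteDimensional ℝ V₃]
    {N : Type*} [NormedAddCommGroup N] [NormedSpace ℝ N] {n : WithTop ℕ∞}
    (m : V₁ →L[ℝ] V₂ →L[ℝ] V₃) {a : N → W [⋀^Fin 1]→L[ℝ] V₁} {η : N → W [⋀^Fin k]→L[ℝ] V₂}
    (ha : ContDiff ℝ n a) (hη : ContDiff ℝ n η) : ContDiff ℝ n fun x => wedgeOne m (a x) (η x) := by
  refine contDiff_alternating_of_apply fun v => ?_
  simp only [wedgeOne_apply]
  refine ContDiff.sum fun i _ => ContDiff.const_smul _ ?_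
  exact (m.contDiff.comp (contDiff_alternating_apply ha _)).clm_apply
    (contDiff_alternating_apply hη _)

theorem intervalIntegral_alternating_apply [CompleteSpace V₁] {f : ℝ → W [⋀^Fin k]→L[ℝ] V₁}
    (hf : Continuous f) (a b : ℝ) (v : Fin k → W) :
    (∫ σ in a..b, f σ) v = ∫ σ in a..b, f σ v :=
  ((ContinuousAlternatingMap.apply ℝ W V₁ v).intervalIntegral_comp_comm
    (hf.intervalIntegrable a b)).symm

theorem intervalIntegral_compContinuousLinearMap [CompleteSpace V₁]
    {W' : Type*} [NormedAddCommGroup W'] [NormedSpace ℝ W'] {f : ℝ → W [⋀^Fin k]→L[ℝ] V₁}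
    (hf : Continuous f) (a b : ℝ) (L : W' →L[ℝ] W) :
    (∫ σ in a..b, f σ).compContinuousLinearMap L =
      ∫ σ in a..b, (f σ).compContinuousLinearMap L :=
  ((ContinuousAlternatingMap.compContinuousLinearMapCLM L).intervalIntegral_comp_comm
    (hf.intervalIntegrable a b)).symm

end FormAlgebra

/-! ### Pullbacks of d_A B and of the fake curvature -/

section PullbackOperations

variable {E : Type*} [NormedAddCommGroup E] [NormedSpace ℝ E]
  {M : Type*} [TopologicalSpace M] [ChartedSpace E M] [IsManifold 𝓘(ℝ, E) ∞ M]
  {W : Type*} [NormedAddCommGroup W] [NormedSpace ℝ W] {k : ℕ}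

theorem MForm.covD_pullback {𝔤 V : Type*} [NormedAddCommGroup 𝔤] [NormedSpace ℝ 𝔤]
    [NormedAddCommGroup V] [NormedSpace ℝ V] (ρ : 𝔤 →L[ℝ] V →L[ℝ] V) (A : MForm E M 1 𝔤)
    {η : MForm E M k V} (hη : η.IsSmooth) {f : W → M} (hf : ContMDiff 𝓘(ℝ, W) 𝓘(ℝ, E) ∞ f) (w : W) :
    (MForm.covD ρ A η).pullback f w =
      extDeriv (η.pullback f) w + wedgeOne ρ (A.pullback f w) (η.pullback f w) := by
  rw [← hη.d_pullback hf, MForm.pullback, MForm.pullback, MForm.pullback, MForm.pullback,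
    wedgeOne_compContinuousLinearMap]
  rfl

variable {𝔤 𝔥 : Type*} [NormedLieRing 𝔤] [NormedLieAlg 𝔤] [FiniteDimensional ℝ 𝔤]
  [NormedLieRing 𝔥] [NormedLieAlg 𝔥] [FiniteDimensional ℝ 𝔥]

theorem fakeCurvature_pullback (𝒞 : DifferentialCrossedModule 𝔤 𝔥) {A : MForm E M 1 𝔤}
    (hA : A.IsSmooth) (B : MForm E M 2 𝔥) {f : W → M} (hf : ContMDiff 𝓘(ℝ, W) 𝓘(ℝ, E) ∞ f) (w : W) :
    (fakeCurvature 𝒞 A B).pullback f w = extDeriv (A.pullback f) w +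
      (1 / 2 : ℝ) • wedgeOne (bracketL 𝔤) (A.pullback f w) (A.pullback f w) +
      𝒞.dtL.compContinuousAlternatingMap (B.pullback f w) := by
  rw [← hA.d_pullback hf, MForm.pullback, MForm.pullback, MForm.pullback, MForm.pullback,
    wedgeOne_compContinuousLinearMap]
  rfl

end PullbackOperations

/-! ### Chen forms on plots of path space -/

section Plots

variable {E : Type*} [NormedAddCommGroup E] [NormedSpace ℝ E]
  {M : Type*} [TopologicalSpace M] [ChartedSpace E M] {s t : M} {n : ℕ}

/-- The map `(u, σ) ↦ p u σ` of a plot `p` of path space. -/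
def plotMap (p : Plot n (SmoothPath E s t)) (q : EuclideanSpace ℝ (Fin n) × ℝ) : M :=
  p.1 q.1 q.2

theorem contMDiff_plotMap (p : Plot n (SmoothPath E s t)) :
    ContMDiff 𝓘(ℝ, EuclideanSpace ℝ (Fin n) × ℝ) 𝓘(ℝ, E) ∞ (plotMap p) :=
  isPlot_iff.mp p.2

theorem velocity_plot (p : Plot n (SmoothPath E s t)) (u : EuclideanSpace ℝ (Fin n)) (σ : ℝ) :
    (p.1 u).velocity σ = tangentMapAt (plotMap p) (u, σ) (0, 1) := by
  have h := tangentMapAt_comp (f := plotMap p) (g := fun τ : ℝ => (u, τ)) (y := σ)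
    ((contMDiff_plotMap p).mdifferentiableAt (by simp)) (by fun_prop)
  rw [(hasFDerivAt_prodMk_right u σ).fderiv] at h
  exact congrArg (fun L : ℝ →L[ℝ] E => L 1) h

theorem tangentMapAt_plot (p : Plot n (SmoothPath E s t)) (u v : EuclideanSpace ℝ (Fin n)) (σ : ℝ) :
    (tangentMapAt (fun w => p.1 w σ) u v : E) = tangentMapAt (plotMap p) (u, σ) (v, 0) := by
  have h := tangentMapAt_comp (f := plotMap p) (g := fun w => (w, σ)) (y := u)
    ((contMDiff_plotMap p).mdifferentiableAt (by simp)) (by fun_prop)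
  rw [(hasFDerivAt_prodMk_left u σ).fderiv] at h
  exact congrArg (fun L : EuclideanSpace ℝ (Fin n) →L[ℝ] E => L v) h

theorem tangentMapAt_plotMap_zero (p : Plot n (SmoothPath E s t))
    (u v : EuclideanSpace ℝ (Fin n)) :
    (tangentMapAt (plotMap p) (u, (0 : ℝ)) (v, 0) : E) = 0 := by
  have h : (fun w => p.1 w 0) = fun _ => s := funext fun w => by
    obtain ⟨ε, hε, h0, -⟩ := (p.1 w).sitting
    exact h0 0 hε.le
  rw [← tangentMapAt_plot, h, tangentMapAt, mfderiv_const]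
  rfl

theorem tangentMapAt_plotMap_one (p : Plot n (SmoothPath E s t))
    (u v : EuclideanSpace ℝ (Fin n)) :
    (tangentMapAt (plotMap p) (u, (1 : ℝ)) (v, 0) : E) = 0 := by
  have h : (fun w => p.1 w 1) = fun _ => t := funext fun w => by
    obtain ⟨ε, hε, -, h1⟩ := (p.1 w).sitting
    exact h1 1 (by linarith)
  rw [← tangentMapAt_plot, h, tangentMapAt, mfderiv_const]
  rfl

variable {V : Type*} [NormedAddCommGroup V] [NormedSpace ℝ V] {k : ℕ}

/-- Velocity and variation are both derivatives of `plotMap`, so contracting with K amounts to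
inserting (0, 1) in the first slot of a single pullback. -/
theorem contractedEval_apply (η : MForm E M (k + 1) V) (p : Plot n (SmoothPath E s t))
    (u : EuclideanSpace ℝ (Fin n)) (σ : ℝ) (v : Fin k → EuclideanSpace ℝ (Fin n)) :
    contractedEval η p u σ v =
      η.pullback (plotMap p) (u, σ) (Matrix.vecCons (0, 1) fun i => (v i, 0)) := by
  have h : (fun i => tangentMapAt (plotMap p) (u, σ)
      ((Matrix.vecCons (0, 1) fun i => (v i, 0) : Fin (k + 1) → _) i) : Fin (k + 1) → E) =
      Matrix.vecCons ((p.1 u).velocity σ) fun i => tangentMapAt (fun w => p.1 w σ) u (v i) := by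
    funext i
    refine Fin.cases ?_ (fun i => ?_) i
    · exact (velocity_plot p u σ).symm
    · exact (tangentMapAt_plot p u (v i) σ).symm
  change η (p.1 u σ) _ = η (p.1 u σ) _
  exact congrArg _ h.symm

theorem contractedEval_reparam {m : ℕ} (η : MForm E M (k + 1) V) (p : Plot n (SmoothPath E s t))
    {f : EuclideanSpace ℝ (Fin m) → EuclideanSpace ℝ (Fin n)} (hf : ContDiff ℝ ∞ f)
    (u : EuclideanSpace ℝ (Fin m)) (σ : ℝ) :
    contractedEval η (⟨p.1 ∘ f, isPlot_reparam p.2 hf⟩ : Plot m (SmoothPath E s t)) u σ =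
      (contractedEval η p (f u) σ).compContinuousLinearMap (fderiv ℝ f u) := by
  have hp : ContMDiff 𝓘(ℝ, EuclideanSpace ℝ (Fin n)) 𝓘(ℝ, E) ∞ fun w => p.1 w σ :=
    (contMDiff_plotMap p).comp (contDiff_prodMk_left σ).contMDiff
  have h := tangentMapAt_comp (f := fun w => p.1 w σ) (g := f) (y := u)
    (hp.mdifferentiableAt (by simp)) (hf.differentiable (by simp) u)
  have h' : tangentMapAt (fun w => (p.1 ∘ f) w σ) u =
      (tangentMapAt (fun w => p.1 w σ) (f u) : _ →L[ℝ] E).comp (fderiv ℝ f u) := h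
  rw [contractedEval, h']
  rfl

variable {𝔤 : Type*} [NormedAddCommGroup 𝔤] [NormedSpace ℝ 𝔤]

/-- Composition is the product in the ring of endomorphisms of V, so transport is a Picard series
with coefficient ρ(A(X')). -/
theorem transportTerm_eq_picardTerm (ρ : 𝔤 →L[ℝ] V →L[ℝ] V) (A : MForm E M 1 𝔤)
    (γ : SmoothPath E s t) (N : ℕ) :
    transportTerm ρ A γ N = picardTerm (fun τ => ρ (A (γ τ) fun _ => γ.velocity τ)) N := by
  induction N with
  | zero => rfl
  | succ N ih =>
    funext σ
    simp only [transportTerm, picardTerm, ih, map_neg]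
    rfl

theorem transport_eq_picardSum (ρ : 𝔤 →L[ℝ] V →L[ℝ] V) (A : MForm E M 1 𝔤)
    (γ : SmoothPath E s t) :
    transport ρ A γ = picardSum (fun τ => ρ (A (γ τ) fun _ => γ.velocity τ)) := by
  funext σ
  simp only [transport, picardSum, transportTerm_eq_picardTerm]

theorem transport_plot (ρ : 𝔤 →L[ℝ] V →L[ℝ] V) (A : MForm E M 1 𝔤)
    (p : Plot n (SmoothPath E s t)) (u : EuclideanSpace ℝ (Fin n)) :
    transport ρ A (p.1 u) =
      picardSum (fun τ => ρ (A.pullback (plotMap p) (u, τ) fun _ => (0, 1))) := by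
  rw [transport_eq_picardSum]
  simp only [velocity_plot]
  rfl

theorem transportedEval_apply (ρ : 𝔤 →L[ℝ] V →L[ℝ] V) (A : MForm E M 1 𝔤)
    (η : MForm E M (k + 1) V) (p : Plot n (SmoothPath E s t))
    (u : EuclideanSpace ℝ (Fin n)) (σ : ℝ) (v : Fin k → EuclideanSpace ℝ (Fin n)) :
    transportedEval ρ A η p u σ v =
      picardSum (fun τ => ρ (A.pullback (plotMap p) (u, τ) fun _ => (0, 1))) σ
        (η.pullback (plotMap p) (u, σ) (Matrix.vecCons (0, 1) fun i => (v i, 0))) := by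
  rw [← contractedEval_apply, ← transport_plot]
  rfl

theorem transportedEval_reparam {m : ℕ} (ρ : 𝔤 →L[ℝ] V →L[ℝ] V) (A : MForm E M 1 𝔤)
    (η : MForm E M (k + 1) V) (p : Plot n (SmoothPath E s t))
    {f : EuclideanSpace ℝ (Fin m) → EuclideanSpace ℝ (Fin n)} (hf : ContDiff ℝ ∞ f)
    (u : EuclideanSpace ℝ (Fin m)) (σ : ℝ) :
    transportedEval ρ A η (⟨p.1 ∘ f, isPlot_reparam p.2 hf⟩ : Plot m (SmoothPath E s t)) u σ =
      (transportedEval ρ A η p (f u) σ).compContinuousLinearMap (fderiv ℝ f u) := by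
  rw [transportedEval, contractedEval_reparam η p hf]
  rfl

variable [IsManifold 𝓘(ℝ, E) ∞ M] [FiniteDimensional ℝ 𝔤] [CompleteSpace V]

theorem summable_transportTerm (ρ : 𝔤 →L[ℝ] V →L[ℝ] V) {A : MForm E M 1 𝔤} (hA : A.IsSmooth)
    (γ : SmoothPath E s t) (σ : ℝ) : Summable fun N => transportTerm ρ A γ N σ := by
  simp only [transportTerm_eq_picardTerm]
  have h : Continuous fun τ => A.pullback γ τ fun _ => (1 : ℝ) :=
    (contDiff_alternating_apply (hA.contDiff_pullback γ.smooth) _).continuous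
  exact summable_picardTerm (ρ.continuous.comp h) σ

variable [FiniteDimensional ℝ V]

theorem contDiff_transportedEval (ρ : 𝔤 →L[ℝ] V →L[ℝ] V) {A : MForm E M 1 𝔤} (hA : A.IsSmooth)
    {η : MForm E M (k + 1) V} (p : Plot n (SmoothPath E s t))
    (hη : ContDiff ℝ ∞ (η.pullback (plotMap p))) :
    ContDiff ℝ ∞ fun q : EuclideanSpace ℝ (Fin n) × ℝ => transportedEval ρ A η p q.1 q.2 := by
  refine contDiff_alternating_of_apply fun v => ?_
  simp only [transportedEval_apply]
  have hA' := contDiff_alternating_apply (hA.contDiff_pullback (contMDiff_plotMap p))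
    (fun _ => (0, 1))
  exact (contDiff_picardSum (ρ.contDiff.comp hA')).clm_apply (contDiff_alternating_apply hη _)

/-- Smoothness of η is asked only of its pullbacks along plots, since this is the form in which it
is available for d_A B and the fake curvature. -/
theorem chenConvergent (ρ : 𝔤 →L[ℝ] V →L[ℝ] V) {A : MForm E M 1 𝔤} (hA : A.IsSmooth)
    {η : MForm E M (k + 1) V} (hη : ∀ (n : ℕ) (p : Plot n (SmoothPath E s t)),
      ContDiff ℝ ∞ (η.pullback (plotMap p))) : ChenConvergent ρ A s t η where
  summable γ σ _ := summable_transportTerm ρ hA γ σ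
  continuousOn n p u :=
    (continuous_line u (contDiff_transportedEval ρ hA p (hη n p))).continuousOn

theorem isDifferentialForm_chen (ρ : 𝔤 →L[ℝ] V →L[ℝ] V) {A : MForm E M 1 𝔤} (hA : A.IsSmooth)
    {η : MForm E M (k + 1) V} (hη : ∀ (n : ℕ) (p : Plot n (SmoothPath E s t)),
      ContDiff ℝ ∞ (η.pullback (plotMap p))) : (chen ρ A s t η).IsDifferentialForm where
  smooth n p := contDiff_intervalIntegral (n := ⊤) (contDiff_transportedEval ρ hA p (hη n p)) 0 1
  compatible m n p f hf u := by
    rw [chen, chen, intervalIntegral_compContinuousLinearMap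
      (continuous_line (f u) (contDiff_transportedEval ρ hA p (hη n p)))]
    simp only [transportedEval_reparam ρ A η p hf]

end Plots

/-! ### The connection, its curvature, and the translation of the identity -/

section ConnectionForms

variable {E : Type*} [NormedAddCommGroup E] [NormedSpace ℝ E]
  {M : Type*} [TopologicalSpace M] [ChartedSpace E M] {s t : M}
  {𝔤 𝔥 : Type*} [NormedLieRing 𝔤] [NormedLieAlg 𝔤] [FiniteDimensional ℝ 𝔤]
  [NormedLieRing 𝔥] [NormedLieAlg 𝔥] [FiniteDimensional ℝ 𝔥]
  (𝒞 : DifferentialCrossedModule 𝔤 𝔥) {A : MForm E M 1 𝔤} {B : MForm E M 2 𝔥}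
  {Φ : MForm E M 2 𝔤} {n : ℕ}

/-- All paths of a plot share their end points, so `plotMap` kills (x, 0) at σ = 0 and σ = 1. This
gives the boundary hypotheses of `curvature_identity`. -/
theorem pullback_plotMap_eq_zero {V : Type*} [NormedAddCommGroup V] [NormedSpace ℝ V] {k : ℕ}
    (η : MForm E M (k + 1) V) (p : Plot n (SmoothPath E s t)) (u x : EuclideanSpace ℝ (Fin n))
    (v : Fin (k + 1) → EuclideanSpace ℝ (Fin n) × ℝ) (hv : v 0 = (x, 0)) :
    η.pullback (plotMap p) (u, 0) v = 0 ∧ η.pullback (plotMap p) (u, 1) v = 0 := by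
  constructor
  · refine ContinuousAlternatingMap.map_coord_zero (η (plotMap p (u, 0))) 0 ?_
    rw [hv]
    exact tangentMapAt_plotMap_zero p u x
  · refine ContinuousAlternatingMap.map_coord_zero (η (plotMap p (u, 1))) 0 ?_
    rw [hv]
    exact tangentMapAt_plotMap_one p u x

theorem chenAct_zero : chenAct 𝒞 A s t B 0 = 0 := by
  funext n p u
  ext v
  have h : ∀ σ, transportedEval (bracketL 𝔤) A (0 : MForm E M 2 𝔤) p u σ = 0 := fun σ => by
    ext w
    rw [transportedEval_apply]
    exact map_zero _
  simp [chenAct, h, wedgeOne_zero]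

variable [IsManifold 𝓘(ℝ, E) ∞ M]

theorem contDiff_covD_pullback (hA : A.IsSmooth) (hB : B.IsSmooth)
    (p : Plot n (SmoothPath E s t)) :
    ContDiff ℝ ∞ ((MForm.covD 𝒞.actL A B).pullback (plotMap p)) := by
  have hf := contMDiff_plotMap p
  rw [funext (MForm.covD_pullback 𝒞.actL A hB hf)]
  exact (contDiff_extDeriv (hB.contDiff_pullback hf)).add
    (contDiff_wedgeOne _ (hA.contDiff_pullback hf) (hB.contDiff_pullback hf))

theorem contDiff_fakeCurvature_pullback (hA : A.IsSmooth) (hB : B.IsSmooth)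
    (p : Plot n (SmoothPath E s t)) :
    ContDiff ℝ ∞ ((fakeCurvature 𝒞 A B).pullback (plotMap p)) := by
  have hf := contMDiff_plotMap p
  have hA' := hA.contDiff_pullback hf
  rw [funext (fakeCurvature_pullback 𝒞 hA B hf)]
  refine ((contDiff_extDeriv hA').add ((contDiff_wedgeOne _ hA' hA').const_smul _)).add ?_
  exact (ContinuousLinearMap.compContinuousAlternatingMapCLM ℝ _ _ _ _ 𝒞.dtL).contDiff.comp
    (hB.contDiff_pullback hf)

/-- The outer variable σ₂ is grouped with u as a parameter, because it is also the upper bound of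
the inner integral. -/
theorem contDiff_wedge_transportedEval (hA : A.IsSmooth) (hB : B.IsSmooth)
    (p : Plot n (SmoothPath E s t)) (hΦ : ContDiff ℝ ∞ (Φ.pullback (plotMap p))) :
    ContDiff ℝ ∞ fun r : (EuclideanSpace ℝ (Fin n) × ℝ) × ℝ =>
      wedgeOne 𝒞.actL.flip (transportedEval 𝒞.actL A B p r.1.1 r.2)
        (transportedEval (bracketL 𝔤) A Φ p r.1.1 r.1.2) := by
  have h₁ := (contDiff_transportedEval 𝒞.actL hA p
    (hB.contDiff_pullback (contMDiff_plotMap p))).comp (by fun_prop : ContDiff ℝ ∞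
      fun r : (EuclideanSpace ℝ (Fin n) × ℝ) × ℝ => (r.1.1, r.2))
  have h₂ := (contDiff_transportedEval (bracketL 𝔤) hA p hΦ).comp (contDiff_fst :
    ContDiff ℝ ∞ fun r : (EuclideanSpace ℝ (Fin n) × ℝ) × ℝ => r.1)
  exact contDiff_wedgeOne _ h₁ h₂

theorem contDiff_integral_wedge_transportedEval (hA : A.IsSmooth) (hB : B.IsSmooth)
    (p : Plot n (SmoothPath E s t)) (hΦ : ContDiff ℝ ∞ (Φ.pullback (plotMap p))) :
    ContDiff ℝ ∞ fun q : EuclideanSpace ℝ (Fin n) × ℝ => ∫ σ₁ in (0 : ℝ)..q.2,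
      wedgeOne 𝒞.actL.flip (transportedEval 𝒞.actL A B p q.1 σ₁)
        (transportedEval (bracketL 𝔤) A Φ p q.1 q.2) :=
  contDiff_intervalIntegral_of_bounds (n := ⊤)
    (contDiff_wedge_transportedEval 𝒞 hA hB p hΦ) contDiff_const contDiff_snd

theorem isDifferentialForm_chenAct (hA : A.IsSmooth) (hB : B.IsSmooth)
    (hΦ : ∀ (n : ℕ) (p : Plot n (SmoothPath E s t)), ContDiff ℝ ∞ (Φ.pullback (plotMap p))) :
    (chenAct 𝒞 A s t B Φ).IsDifferentialForm where
  smooth n p := contDiff_intervalIntegral (n := ⊤)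
    (contDiff_integral_wedge_transportedEval 𝒞 hA hB p (hΦ n p)) 0 1
  compatible m n p f hf u := by
    rw [chenAct, chenAct, intervalIntegral_compContinuousLinearMap
      (continuous_line (f u) (contDiff_integral_wedge_transportedEval 𝒞 hA hB p (hΦ n p)))]
    refine intervalIntegral.integral_congr fun σ₂ _ => ?_
    simp only [transportedEval_reparam _ A _ p hf, wedgeOne_compContinuousLinearMap]
    rw [intervalIntegral_compContinuousLinearMap
      (continuous_line (f u, σ₂) (contDiff_wedge_transportedEval 𝒞 hA hB p (hΦ n p)))]

theorem chen_apply (ρ : 𝔤 →L[ℝ] 𝔥 →L[ℝ] 𝔥) (hA : A.IsSmooth) {k : ℕ} {η : MForm E M (k + 1) 𝔥}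
    (p : Plot n (SmoothPath E s t)) (hη : ContDiff ℝ ∞ (η.pullback (plotMap p)))
    (u : EuclideanSpace ℝ (Fin n)) (v : Fin k → EuclideanSpace ℝ (Fin n)) :
    chen ρ A s t η n p u v = ∫ σ in (0 : ℝ)..1,
      picardSum (fun τ => ρ (A.pullback (plotMap p) (u, τ) fun _ => (0, 1))) σ
        (η.pullback (plotMap p) (u, σ) (Matrix.vecCons (0, 1) fun i => (v i, 0))) := by
  rw [chen, intervalIntegral_alternating_apply
    (continuous_line u (contDiff_transportedEval ρ hA p hη))]
  simp only [transportedEval_apply]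

theorem chenAct_apply (hA : A.IsSmooth) (hB : B.IsSmooth) (p : Plot n (SmoothPath E s t))
    (hΦ : ContDiff ℝ ∞ (Φ.pullback (plotMap p))) (u x y : EuclideanSpace ℝ (Fin n)) :
    chenAct 𝒞 A s t B Φ n p u ![x, y] = ∫ σ in (0 : ℝ)..1, ∫ τ in (0 : ℝ)..σ,
      (𝒞.actL (transportedEval (bracketL 𝔤) A Φ p u σ fun _ => y)
          (transportedEval 𝒞.actL A B p u τ fun _ => x) -
        𝒞.actL (transportedEval (bracketL 𝔤) A Φ p u σ fun _ => x)
          (transportedEval 𝒞.actL A B p u τ fun _ => y)) := by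
  rw [chenAct, intervalIntegral_alternating_apply
    (continuous_line u (contDiff_integral_wedge_transportedEval 𝒞 hA hB p hΦ))]
  refine intervalIntegral.integral_congr fun σ _ => ?_
  refine (intervalIntegral_alternating_apply
    (continuous_line (u, σ) (contDiff_wedge_transportedEval 𝒞 hA hB p hΦ)) 0 σ _).trans ?_
  simp only [wedgeOne_apply_two, ContinuousLinearMap.flip_apply]

theorem half_smul_bracketL_sub (x y : 𝔥) :
    (1 / 2 : ℝ) • (bracketL 𝔥 x y - bracketL 𝔥 y x) = bracketL 𝔥 x y := by
  rw [bracketL_apply, bracketL_apply, ← lie_skew y x, sub_neg_eq_add, ← two_smul ℝ, smul_smul]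
  norm_num

theorem curvature_apply {X : Type*} [DiffeologicalSpace X] (𝒜 : PlotForm X 1 𝔥) (p : Plot n X)
    (h : ContDiff ℝ ∞ (𝒜 n p)) (u x y : EuclideanSpace ℝ (Fin n)) :
    𝒜.curvature n p u ![x, y] = fderiv ℝ (fun w => 𝒜 n p w fun _ => y) u x -
      fderiv ℝ (fun w => 𝒜 n p w fun _ => x) u y +
        bracketL 𝔥 (𝒜 n p u fun _ => x) (𝒜 n p u fun _ => y) := by
  have h1 : 𝒜.curvature n p u ![x, y] = extDeriv (𝒜 n p) u ![x, y] +
      (1 / 2 : ℝ) • wedgeOne (bracketL 𝔥) (𝒜 n p u) (𝒜 n p u) ![x, y] := rfl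
  rw [h1, extDeriv_apply_two (h.differentiable (by simp) u), wedgeOne_apply_two]
  rw [half_smul_bracketL_sub]

theorem standardConnection_curvature (hA : A.IsSmooth) (hB : B.IsSmooth) :
    (standardConnection 𝒞 A B s t).curvature =
      -chen 𝒞.actL A s t (MForm.covD 𝒞.actL A B) - chenAct 𝒞 A s t B (fakeCurvature 𝒞 A B) := by
  funext n p u
  ext v
  obtain ⟨x, y, rfl⟩ : ∃ x y, v = ![x, y] := ⟨v 0, v 1, by ext i; fin_cases i <;> rfl⟩
  have hf := contMDiff_plotMap p
  have ha := hA.contDiff_pullback hf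
  have hb := hB.contDiff_pullback hf
  have hΦ := contDiff_fakeCurvature_pullback 𝒞 hA hB p
  have hH := contDiff_covD_pullback 𝒞 hA hB p
  have hadiff := fun q => ha.differentiable (by simp) q
  have hbdiff := fun q => hb.differentiable (by simp) q
  have hcons : ∀ z : EuclideanSpace ℝ (Fin n),
      (Matrix.vecCons (0, 1) fun _ => (z, 0) : Fin 2 → EuclideanSpace ℝ (Fin n) × ℝ) =
        ![(0, 1), (z, 0)] := fun z => by ext i <;> fin_cases i <;> rfl
  have hcons₂ : (Matrix.vecCons (0, 1) fun i => (![x, y] i, 0) :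
      Fin 3 → EuclideanSpace ℝ (Fin n) × ℝ) = ![(0, 1), (x, 0), (y, 0)] := by
    ext i <;> fin_cases i <;> rfl
  have hΦapply : ∀ (z : EuclideanSpace ℝ (Fin n)) (σ : ℝ),
      (fakeCurvature 𝒞 A B).pullback (plotMap p) (u, σ) ![(0, 1), (z, 0)] =
        fderiv ℝ (fun q => A.pullback (plotMap p) q fun _ => (z, 0)) (u, σ) (0, 1) -
        fderiv ℝ (fun q => A.pullback (plotMap p) q fun _ => (0, 1)) (u, σ) (z, 0) +
        bracketL 𝔤 (A.pullback (plotMap p) (u, σ) fun _ => (0, 1))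
          (A.pullback (plotMap p) (u, σ) fun _ => (z, 0)) +
        𝒞.dtL (B.pullback (plotMap p) (u, σ) ![(0, 1), (z, 0)]) := fun z σ => by
    rw [fakeCurvature_pullback 𝒞 hA B hf]
    rw [ContinuousAlternatingMap.add_apply, ContinuousAlternatingMap.add_apply,
      ContinuousAlternatingMap.smul_apply, extDeriv_apply_two (hadiff _), wedgeOne_apply_two,
      half_smul_bracketL_sub]
    rfl
  -- The components of A and B in the directions (0, 1), (x, 0), (y, 0). These are constant vector
  -- fields, so the exterior derivatives contain no bracket terms.
  have hmain := 𝒞.curvature_identity (x := u) (v := x) (w := y)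
    (aK := fun q => A.pullback (plotMap p) q fun _ => (0, 1))
    (aV := fun q => A.pullback (plotMap p) q fun _ => (x, 0))
    (aU := fun q => A.pullback (plotMap p) q fun _ => (y, 0))
    (bV := fun q => B.pullback (plotMap p) q ![(0, 1), (x, 0)])
    (bU := fun q => B.pullback (plotMap p) q ![(0, 1), (y, 0)])
    (bVU := fun q => B.pullback (plotMap p) q ![(x, 0), (y, 0)])
    (contDiff_alternating_apply ha _) (contDiff_alternating_apply ha _)
    (contDiff_alternating_apply ha _) (contDiff_alternating_apply hb _)
    (contDiff_alternating_apply hb _) (contDiff_alternating_apply hb _)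
    (pullback_plotMap_eq_zero A p u x _ rfl).2 (pullback_plotMap_eq_zero A p u y _ rfl).2
    (pullback_plotMap_eq_zero B p u x _ rfl).1 (pullback_plotMap_eq_zero B p u x _ rfl).2
    (H := fun σ => (MForm.covD 𝒞.actL A B).pullback (plotMap p) (u, σ)
      ![(0, 1), (x, 0), (y, 0)])
    (fun σ => by
      rw [MForm.covD_pullback 𝒞.actL A hB hf]
      rw [ContinuousAlternatingMap.add_apply, extDeriv_apply_three (hbdiff _), wedgeOne_apply_three])
    (hΦapply x) (hΦapply y) rfl rfl
  have hA1 := (isDifferentialForm_chen (s := s) (t := t) 𝒞.actL hA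
    fun n p => hB.contDiff_pullback (contMDiff_plotMap p)).smooth n p
  have hlhs := curvature_apply (standardConnection 𝒞 A B s t) p hA1 u x y
  have hrhs : (-chen 𝒞.actL A s t (MForm.covD 𝒞.actL A B) -
      chenAct 𝒞 A s t B (fakeCurvature 𝒞 A B)) n p u ![x, y] =
      -(chen 𝒞.actL A s t (MForm.covD 𝒞.actL A B) n p u ![x, y]) -
      chenAct 𝒞 A s t B (fakeCurvature 𝒞 A B) n p u ![x, y] := rfl
  rw [hlhs, hrhs]
  simp only [standardConnection, chen_apply _ hA p hb, chen_apply _ hA p hH,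
    chenAct_apply 𝒞 hA hB p hΦ, transportedEval_apply, hcons, hcons₂]
  exact hmain

end ConnectionForms

end PathCurvature

end

theorem mainTheorem10
    {E : Type*} [NormedAddCommGroup E] [NormedSpace ℝ E] [FiniteDimensional ℝ E]
    {M : Type*} [TopologicalSpace M] [ChartedSpace E M] [IsManifold 𝓘(ℝ, E) ∞ M]
    {𝔤 : Type*} [PathCurvature.NormedLieRing 𝔤] [PathCurvature.NormedLieAlg 𝔤]
    [FiniteDimensional ℝ 𝔤]
    {𝔥 : Type*} [PathCurvature.NormedLieRing 𝔥] [PathCurvature.NormedLieAlg 𝔥]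
    [FiniteDimensional ℝ 𝔥]
    (𝒞 : PathCurvature.DifferentialCrossedModule 𝔤 𝔥)
    (A : PathCurvature.MForm E M 1 𝔤) (hA : A.IsSmooth)
    (B : PathCurvature.MForm E M 2 𝔥) (hB : B.IsSmooth)
    (s t : M) :
    -- the transport series converge and the integrands are continuous
    PathCurvature.ChenConvergent 𝒞.actL A s t B ∧
    PathCurvature.ChenConvergent 𝒞.actL A s t (PathCurvature.MForm.covD 𝒞.actL A B) ∧
    PathCurvature.ChenConvergent (PathCurvature.bracketL 𝔤) A s t
      (PathCurvature.fakeCurvature 𝒞 A B) ∧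
    -- all path space forms involved are differential forms
    (PathCurvature.standardConnection 𝒞 A B s t).IsDifferentialForm ∧
    (PathCurvature.chen 𝒞.actL A s t
      (PathCurvature.MForm.covD 𝒞.actL A B)).IsDifferentialForm ∧
    (PathCurvature.chenAct 𝒞 A s t B
      (PathCurvature.fakeCurvature 𝒞 A B)).IsDifferentialForm ∧
    -- the curvature
    (PathCurvature.standardConnection 𝒞 A B s t).curvature =
      -PathCurvature.chen 𝒞.actL A s t (PathCurvature.MForm.covD 𝒞.actL A B)
        - PathCurvature.chenAct 𝒞 A s t B (PathCurvature.fakeCurvature 𝒞 A B) ∧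
    -- the case of vanishing fake curvature
    (PathCurvature.fakeCurvature 𝒞 A B = 0 →
      (PathCurvature.standardConnection 𝒞 A B s t).curvature =
        -PathCurvature.chen 𝒞.actL A s t (PathCurvature.curvature3Form 𝒞 A B)) := by
  have hcov := fun n (p : PathCurvature.Plot n (PathCurvature.SmoothPath E s t)) =>
    PathCurvature.contDiff_covD_pullback 𝒞 hA hB p
  have hfake := fun n (p : PathCurvature.Plot n (PathCurvature.SmoothPath E s t)) =>
    PathCurvature.contDiff_fakeCurvature_pullback 𝒞 hA hB p
  have hBp := fun n (p : PathCurvature.Plot n (PathCurvature.SmoothPath E s t)) =>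
    hB.contDiff_pullback (PathCurvature.contMDiff_plotMap p)
  have hcurv := PathCurvature.standardConnection_curvature 𝒞 (s := s) (t := t) hA hB
  refine ⟨PathCurvature.chenConvergent _ hA hBp, PathCurvature.chenConvergent _ hA hcov,
    PathCurvature.chenConvergent _ hA hfake, PathCurvature.isDifferentialForm_chen _ hA hBp,
    PathCurvature.isDifferentialForm_chen _ hA hcov,
    PathCurvature.isDifferentialForm_chenAct 𝒞 hA hB hfake, hcurv, fun h => ?_⟩
  rw [hcurv, h, PathCurvature.chenAct_zero, sub_zero]
  rfl
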